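/- **Setting.** Let $H$ be a Hamiltonian on $n$ qubits with a layered decomposition $$H=\sum_{\chi=1}^{g} w_\chi H_\chi,\qquad H_\chi=\frac1{m_\chi}\sum_{i=1}^{m_\chi}\Pi_i^\chi ,$$ where $w_\chi>0$, $\sum_\chi w_\chi=1$, $m_\chi\ge 1$, and for each $\chi$ the operators $\Pi^\chi_1,\dots,\Pi^\chi_{m_\chi}$ are pairwise commuting orthogonal projections. Put $m=\sum_\chi m_\chi$ (the number of terms) and $\omega_{\min}=(\min_\chi w_\chi)^{-1}$. Such a Hamiltonian is $k$-local if each of its terms $\Pi^\chi_i$ acts on at most $k$ qubits. Let $0\le\lambda<d$ with $d\in\mathbb N$, and for each $\chi$ let $G_\chi$ be an undirected $d$-regular graph (loops and parallel edges allowed) on the vertex set $\{1,\dots,m_\chi\}$ that is a $\lambda$-spectral expander: if $\lambda_1\ge\lambda_2\ge\dots\ge\lambda_{m_\chi}$ are the eigenvalues of its adjacency matrix with multiplicity, then $|\lambda_i|\le\lambda$ for all $i\ne1$. Put $\mu=\lambda/d$ and $$C_\mu=\max_{i\in\mathbb Z}\ \sum_{j\in\mathbb Z,\,j\neq i}\mu^{|j-i|}.$$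 For $T\ge1$ let $\mathcal F_\chi$ be the family of all paths $f=(f(1),\dots,f(T))$ with $T$ vertices in $G_\chi$ (vertices may be revisited; paths along different parallel edges are counted separately). The derandomised $T$-fold tensor product amplification of $H$ is the layered Hamiltonian on $T$ copies of the $n$ qubits $$H^{(T)}=\sum_{\chi} w_\chi\,\frac1{|\mathcal F_\chi|}\sum_{f\in\mathcal F_\chi}\Pi^\chi_f ,\qquad \Pi^\chi_f=\mathbb I-\bigotimes_{j=1}^{T}\bigl(\mathbb I-\Pi^\chi_{f(j)}\bigr),$$ with terms $\Pi_f^\chi$, $f\in\mathcal F_\chi$. Write $\lambda_{\min}$ for the lowest eigenvalue and $\log$ for the natural logarithm. **Theorem (Gap amplification).** For every integer $t\ge1$: 1. If $H$ is $k$-local, then $H^{(2t)}$ is $2tk$-local. $H^{(2t)}$ has exactly $d^{2t-1}m$ terms, hence at most $d^{2t}m$ terms. 2. (Completeness) $\lambda_{\min}(H^{(2t)})\le 2t\cdot\lambda_{\min}(H)$. 3. (Soundness) $C_\mu\le 2/(1-\mu)$, and if $t\ge10^5$, then $$\lambda_{\min}(H^{(2t)})\ \ge\ \min\left\{\frac13\cdot\frac{\log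 t}{t},\ \ \lambda_{\min}(H)\cdot\sqrt{\frac{t}{\log t}}\cdot\frac1{20}\bigl[\max\{1+C_\mu,\ \omega_{\min}\}\bigr]^{-1}\right\}.$$ -/

import Mathlib

noncomputable section

/-! ### Operators on qubits

For a finite set `Q` of qubits the Hilbert space `(ℂ²)^{⊗ Q}` has the computational basis
`Q → Fin 2`, and an operator on it is a matrix indexed by `Q → Fin 2`. -/

/-- Operators on the qubits labelled by `Q`. -/
abbrev QubitOp (Q : Type) : Type := Matrix (Q → Fin 2) (Q → Fin 2) ℂ

/-- `A` acts only on the qubits in `S`: it is `B ⊗ 𝟙` for an operator `B` on the qubits in `S`. -/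
def QubitOp.ActsOn {Q : Type} (A : QubitOp Q) (S : Finset Q) : Prop :=
  ∃ B : QubitOp {q : Q // q ∈ S}, ∀ x y : Q → Fin 2,
    ((∀ q, q ∉ S → x q = y q) → A x y = B (fun q => x q) (fun q => y q)) ∧
    (¬ (∀ q, q ∉ S → x q = y q) → A x y = 0)

/-- `A` is `k`-local: it acts on at most `k` qubits. -/
def QubitOp.IsLocal {Q : Type} (k : ℕ) (A : QubitOp Q) : Prop :=
  ∃ S : Finset Q, S.card ≤ k ∧ A.ActsOn S

/-- The lowest eigenvalue of a Hermitian operator on qubits: the least element of its (finite,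
nonempty, real) spectrum. -/
def lambdaMin {Q : Type} [Fintype Q] [DecidableEq Q] (A : QubitOp Q) : ℝ :=
  sInf (spectrum ℝ A)

/-- The tensor product `⨂_{j ∈ [T]} A_j`, acting on `T` registers, each of which is a copy of `Q`;
the qubit `(j, q)` is the qubit `q` of the `j`-th register. -/
def tensorOp {Q : Type} {T : ℕ} (A : Fin T → QubitOp Q) : QubitOp (Fin T × Q) :=
  Matrix.of fun x y => ∏ j : Fin T, A j (fun q => x (j, q)) (fun q => y (j, q))

theorem tensorOp_star {Q : Type} {T : ℕ} (A : Fin T → QubitOp Q) :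
    star (tensorOp A) = tensorOp (fun j => star (A j)) := by
  ext x y
  simp [tensorOp, Matrix.star_apply, Matrix.of_apply]

section tensor

variable {Q : Type} [Fintype Q] [DecidableEq Q] {T : ℕ}

theorem tensorOp_mul (A B : Fin T → QubitOp Q) :
    tensorOp A * tensorOp B = tensorOp (fun j => A j * B j) := by
  ext x y
  simp only [tensorOp, Matrix.mul_apply, Matrix.of_apply, Finset.prod_univ_sum,
    Fintype.piFinset_univ, ← Finset.prod_mul_distrib]
  exact Fintype.sum_equiv (Equiv.curry (Fin T) Q (Fin 2)) _ _ (fun z => rfl)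

theorem tensorOp_isStarProjection {A : Fin T → QubitOp Q} (hA : ∀ j, IsStarProjection (A j)) :
    IsStarProjection (tensorOp A) where
  isIdempotentElem := by
    unfold IsIdempotentElem
    rw [tensorOp_mul]
    congr 1
    funext j
    exact (hA j).isIdempotentElem
  isSelfAdjoint := by
    unfold IsSelfAdjoint
    rw [tensorOp_star]
    congr 1
    funext j
    exact (hA j).isSelfAdjoint

theorem tensorOp_commute {A B : Fin T → QubitOp Q} (h : ∀ j, Commute (A j) (B j)) :
    Commute (tensorOp A) (tensorOp B) := by
  unfold Commute SemiconjBy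
  rw [tensorOp_mul, tensorOp_mul]
  congr 1
  funext j
  exact h j

end tensor

/-! ### Layered Hamiltonians -/

/-- A layered Hamiltonian on the qubits `Q`, given through its decomposition: `g` layers with
positive weights `w χ` that sum to `1`, the layer `χ` consisting of a finite nonempty family of
pairwise commuting orthogonal projections `proj χ i`, `i : Term χ`
(`Term χ = Fin (m χ)` for a layer with `m χ` enumerated terms). -/
structure LayeredHamiltonian (Q : Type) [Fintype Q] [DecidableEq Q] where
  g : ℕ
  Term : Fin g → Type
  fintypeTerm : ∀ χ, Fintype (Term χ)
  nonemptyTerm : ∀ χ, Nonempty (Term χ)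
  w : Fin g → ℝ
  w_pos : ∀ χ, 0 < w χ
  w_sum : ∑ χ, w χ = 1
  proj : ∀ χ, Term χ → QubitOp Q
  isProj : ∀ χ i, IsStarProjection (proj χ i)
  commute : ∀ χ i j, Commute (proj χ i) (proj χ j)

attribute [instance] LayeredHamiltonian.fintypeTerm LayeredHamiltonian.nonemptyTerm

namespace LayeredHamiltonian

variable {Q : Type} [Fintype Q] [DecidableEq Q]

/-- The layer `H_χ`, the average of its projections. -/
def layer (H : LayeredHamiltonian Q) (χ : Fin H.g) : QubitOp Q :=
  ((Fintype.card (H.Term χ) : ℂ)⁻¹) • ∑ i : H.Term χ, H.proj χ i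

/-- The operator `H = ∑ χ, w χ • H_χ`. -/
def op (H : LayeredHamiltonian Q) : QubitOp Q :=
  ∑ χ, (H.w χ : ℂ) • H.layer χ

/-- The total number of terms `m = ∑ χ, m_χ`. -/
def numTerms (H : LayeredHamiltonian Q) : ℕ := ∑ χ, Fintype.card (H.Term χ)

/-- `H` is `k`-local: each of its terms is. -/
def IsLocal (k : ℕ) (H : LayeredHamiltonian Q) : Prop :=
  ∀ χ i, (H.proj χ i).IsLocal k

/-- `ω_min = (min_χ w χ)⁻¹`. -/
def omegaMin (H : LayeredHamiltonian Q) : ℝ := (⨅ χ, H.w χ)⁻¹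

end LayeredHamiltonian

/-! ### Expander graphs and walks -/

/-- A `d`-regular undirected graph on `V`, loops and parallel edges allowed, given by its adjacency
matrix: `adj u v` is the number of edges that lead from `u` to `v`. -/
structure RegularGraph (V : Type) [Fintype V] (d : ℕ) where
  adj : Matrix V V ℕ
  symm : adj.IsSymm
  regular : ∀ v, ∑ u, adj v u = d

namespace RegularGraph

variable {V : Type} [Fintype V] {d : ℕ}

theorem isHermitian_adj (G : RegularGraph V d) :
    (G.adj.map (fun a : ℕ => (a : ℝ))).IsHermitian := by
  ext u v
  simp [Matrix.conjTranspose_apply, G.symm.apply u v]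

open Classical in
/-- `G` is a `lam`-spectral expander: with the eigenvalues of the adjacency matrix listed in
nonincreasing order with multiplicity, all but the first have absolute value at most `lam`. -/
def IsSpectralExpander (G : RegularGraph V d) (lam : ℝ) : Prop :=
  ∀ i : Fin (Fintype.card V), (i : ℕ) ≠ 0 → |G.isHermitian_adj.eigenvalues₀ i| ≤ lam

/-- The paths `(f 1, …, f T)` in `G` with `T` vertices: vertices `f j` together with, for each of the
`T - 1` steps, one of the edges from `f j` to `f (j + 1)`. Vertices may be revisited. If `G` has no
parallel edges, a path is determined by its vertices. -/
def Path (G : RegularGraph V d) (T : ℕ) : Type :=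
  Σ f : Fin T → V, ∀ j : Fin (T - 1),
    Fin (G.adj (f ⟨j, by omega⟩) (f ⟨j + 1, by omega⟩))

instance (G : RegularGraph V d) (T : ℕ) : Fintype (G.Path T) :=
  inferInstanceAs (Fintype (Σ f : Fin T → V, ∀ j : Fin (T - 1),
    Fin (G.adj (f ⟨j, by omega⟩) (f ⟨j + 1, by omega⟩))))

/-- The `j`-th vertex of a path. -/
def Path.vertex {G : RegularGraph V d} {T : ℕ} (p : G.Path T) (j : Fin T) : V := p.1 j

theorem exists_adj [NeZero d] (G : RegularGraph V d) (v : V) : ∃ u, 0 < G.adj v u := by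
  by_contra h
  push Not at h
  have h0 : ∑ u, G.adj v u = 0 := Finset.sum_eq_zero fun u _ => Nat.le_zero.mp (h u)
  exact NeZero.ne d ((G.regular v).symm.trans h0)

instance [NeZero d] [Nonempty V] (G : RegularGraph V d) (T : ℕ) : Nonempty (G.Path T) := by
  choose s hs using G.exists_adj
  exact ⟨⟨fun j => s^[j] (Classical.arbitrary V), fun j => ⟨0, by
    simpa only [Function.iterate_succ_apply'] using hs _⟩⟩⟩

end RegularGraph

/-- The constant `C_μ = max_i ∑_{j ≠ i} μ^{|j - i|}`, with `i`, `j` ranging over all integers, so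
that it depends on `μ` only. -/
def walkConst (μ : ℝ) : ℝ :=
  ⨆ i : ℤ, ∑' j : {j : ℤ // j ≠ i}, μ ^ ((j : ℤ) - i).natAbs

/-! ### The amplified Hamiltonian -/

namespace LayeredHamiltonian

variable {Q : Type} [Fintype Q] [DecidableEq Q]

/-- The derandomised `T`-fold tensor product amplification of `H` along `d`-regular graphs `G χ` on
the terms of the layers. It acts on `T` registers, has the same weights, and the terms of its layer
`χ` are `𝟙 - ⨂_j (𝟙 - Π_{f j})` for the paths `f` with `T` vertices in `G χ`. -/
def amplify (H : LayeredHamiltonian Q) {d : ℕ} [NeZero d]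
    (G : ∀ χ, RegularGraph (H.Term χ) d) (T : ℕ) : LayeredHamiltonian (Fin T × Q) where
  g := H.g
  Term := fun χ => (G χ).Path T
  fintypeTerm := fun _ => inferInstance
  nonemptyTerm := fun _ => inferInstance
  w := H.w
  w_pos := H.w_pos
  w_sum := H.w_sum
  proj := fun χ f => 1 - tensorOp (fun j => 1 - H.proj χ (f.vertex j))
  isProj := fun χ f => (tensorOp_isStarProjection fun j => (H.isProj χ (f.vertex j)).one_sub).one_sub
  commute := fun χ f f' => by
    have h : Commute (tensorOp (fun j => 1 - H.proj χ (f.vertex j)))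
        (tensorOp (fun j => 1 - H.proj χ (f'.vertex j))) := by
      refine tensorOp_commute fun j => ?_
      have h1 : Commute (1 - H.proj χ (f.vertex j)) (H.proj χ (f'.vertex j)) :=
        (Commute.one_left _).sub_left (H.commute χ _ _)
      exact (Commute.one_right _).sub_right h1
    have h1 : Commute (1 - tensorOp (fun j => 1 - H.proj χ (f.vertex j)))
        (tensorOp (fun j => 1 - H.proj χ (f'.vertex j))) :=
      (Commute.one_left _).sub_left h
    exact (Commute.one_right _).sub_right h1

end LayeredHamiltonian

end

/-! Commuting projections of one layer can be measured jointly: an outcome is the set `S` of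
violated terms. On `T` registers the outcome is a tuple of sets `S j`, and both the amplified layer
and the tensor powers built from `H_χ` are functions of this tuple. So operator inequalities within
a layer reduce to inequalities between numbers, with `ε j` the density of `S j` and `p` the fraction
of paths that hit some `S j` at time `j`.

Soundness rests on a second moment bound. Let `X` count the hits of a random path, with mean `a = ∑
ε j`. Expander mixing makes the correlations of two times decay like `μ^|j - i|`, so `E X² ≤ a + a²
+ C_μ a`, and Cauchy–Schwarz gives `a ≤ p (1 + C_μ + a)` (`sum_le_hitProb_mul`). Hence `1 - ∏ (1 - w
ε j) ≤ (1 + C_μ + ω_min) w p`, which says that `1 - (1 - w H_χ)^⊗T` is at most `1 + C_μ + ω_min`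
times the weighted amplified layer. Different layers need not commute; the operator union bound
`one_sub_tensorOp_sum_le` combines them into `1 - (1 - H)^⊗T ≤ (1 + C_μ + ω_min) H^(T)`. The left
side is at least `1 - (1 - λ_min(H))^T`, and elementary estimates finish.

Completeness is the bound `p ≤ ∑ ε j` evaluated on a product of ground states. The bound `ε j ≤ p`
gives `λ_min(H) ≤ λ_min(H^(T))`, which settles the case of large `λ_min(H)`. -/

/-! ### Tensor products of operators and the positive semidefinite order. -/

section TensorOp

open scoped ComplexOrder MatrixOrder

variable {Q : Type} {T : ℕ}

/-- The tensor product of operators as a multilinear map. -/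
def tensorMultilinear (Q : Type) (T : ℕ) :
    MultilinearMap ℂ (fun _ : Fin T => QubitOp Q) (QubitOp (Fin T × Q)) where
  toFun := tensorOp
  map_update_add' {inst} m i a b := by
    ext x y
    have key : ∀ A : Fin T → QubitOp Q, tensorOp A x y =
        (MultilinearMap.mkPiAlgebra ℂ (Fin T) ℂ).compLinearMap
          (fun j => Matrix.entryLinearMap ℂ ℂ (fun q => x (j, q)) (fun q => y (j, q))) A :=
      fun A => by simp [tensorOp]
    rw [Matrix.add_apply, key, key, key, MultilinearMap.map_update_add]
  map_update_smul' {inst} m i c a := by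
    ext x y
    have key : ∀ A : Fin T → QubitOp Q, tensorOp A x y =
        (MultilinearMap.mkPiAlgebra ℂ (Fin T) ℂ).compLinearMap
          (fun j => Matrix.entryLinearMap ℂ ℂ (fun q => x (j, q)) (fun q => y (j, q))) A :=
      fun A => by simp [tensorOp]
    rw [Matrix.smul_apply, key, key, MultilinearMap.map_update_smul]

theorem tensorMultilinear_apply (A : Fin T → QubitOp Q) :
    tensorMultilinear Q T A = tensorOp A := rfl

variable [Fintype Q]

theorem tensorOp_one : tensorOp (fun _ : Fin T => (1 : QubitOp Q)) = 1 := by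
  ext x y
  simp only [tensorOp, Matrix.of_apply, Matrix.one_apply, Finset.prod_ite_zero, Finset.prod_const_one]
  refine if_congr ?_ rfl rfl
  constructor
  · intro h
    funext ⟨j, q⟩
    exact congrFun (h j (Finset.mem_univ j)) q
  · rintro rfl j -
    rfl

/-- The operator that acts as `A` on the registers before `k`, as `B` on the register `k`, and
trivially on the registers after `k`. -/
def prefixOp (A B : QubitOp Q) (k : Fin T) : QubitOp (Fin T × Q) :=
  tensorOp fun j => if j < k then A else if j = k then B else 1

/-- Telescoping: `U n` carries `1 - Z` on the first `n` registers only, and consecutive members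
differ by `Z` on one register. -/
theorem one_sub_tensorOp_const (Z : QubitOp Q) :
    1 - tensorOp (fun _ : Fin T => 1 - Z) = ∑ k : Fin T, prefixOp (1 - Z) Z k := by
  let U : ℕ → QubitOp (Fin T × Q) := fun n => tensorOp fun j => if (j : ℕ) < n then 1 - Z else 1
  have hstep : ∀ k : Fin T, prefixOp (1 - Z) Z k = U k - U (k + 1) := by
    intro k
    let B : Fin T → QubitOp Q := fun j => if j < k then 1 - Z else 1
    have h1 : U k = tensorMultilinear Q T (Function.update B k 1) := by
      rw [tensorMultilinear_apply]
      refine congrArg tensorOp (funext fun j => ?_)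
      rcases eq_or_ne j k with rfl | h
      · simp
      · simp [B, h]
    have h2 : U (k + 1) = tensorMultilinear Q T (Function.update B k (1 - Z)) := by
      rw [tensorMultilinear_apply]
      refine congrArg tensorOp (funext fun j => ?_)
      rcases eq_or_ne j k with rfl | h
      · simp
      · have : ((j : ℕ) < k + 1) ↔ j < k := by
          rw [Fin.lt_def]
          have := Fin.val_ne_of_ne h
          omega
        simp [B, h, this]
    have h3 : prefixOp (1 - Z) Z k = tensorMultilinear Q T (Function.update B k Z) := by
      rw [tensorMultilinear_apply, prefixOp]
      refine congrArg tensorOp (funext fun j => ?_)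
      rcases eq_or_ne j k with rfl | h
      · simp
      · simp [B, h]
    rw [h1, h2, h3, ← MultilinearMap.map_update_sub, sub_sub_cancel]
  have h0 : U 0 = 1 := by simpa [U] using tensorOp_one
  have hT : U T = tensorOp (fun _ : Fin T => 1 - Z) := by simp [U]
  rw [← h0, ← hT, Finset.sum_congr rfl fun k _ => hstep k,
    Fin.sum_univ_eq_sum_range (fun n => U n - U (n + 1)) T, Finset.sum_range_sub']

theorem prefixOp_sum {ι : Type*} [Fintype ι] (A : QubitOp Q) (Z : ι → QubitOp Q) (k : Fin T) :
    prefixOp A (∑ χ, Z χ) k = ∑ χ, prefixOp A (Z χ) k := by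
  have h : ∀ B : QubitOp Q, prefixOp A B k = tensorMultilinear Q T
      (Function.update (fun j => if j < k then A else 1) k B) := by
    intro B
    rw [tensorMultilinear_apply, prefixOp]
    refine congrArg tensorOp (funext fun j => ?_)
    rcases eq_or_ne j k with rfl | h
    · simp
    · simp [h]
  simp only [h, MultilinearMap.map_update_sum]

variable [DecidableEq Q]

theorem tensorOp_nonneg {A : Fin T → QubitOp Q} (hA : ∀ j, 0 ≤ A j) : 0 ≤ tensorOp A := by
  have h : ∀ j, ∃ B : QubitOp Q, A j = star B * B :=
    fun j => CStarAlgebra.nonneg_iff_eq_star_mul_self.mp (hA j)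
  choose B hB using h
  rw [show A = fun j => star (B j) * B j from funext hB, ← tensorOp_mul, ← tensorOp_star,
    Matrix.nonneg_iff_posSemidef]
  exact Matrix.posSemidef_conjTranspose_mul_self _

/-- Expanding `B = A + (B - A)` multilinearly yields positive summands, one of which is `tensorOp
A`. -/
theorem tensorOp_mono {A B : Fin T → QubitOp Q} (hA : ∀ j, 0 ≤ A j) (hAB : ∀ j, A j ≤ B j) :
    tensorOp A ≤ tensorOp B := by
  classical
  have h : tensorOp B = ∑ s : Finset (Fin T), tensorOp (s.piecewise A (B - A)) := by
    have := (tensorMultilinear Q T).map_add_univ A (B - A)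
    rwa [add_sub_cancel] at this
  have hu : tensorOp A = tensorOp ((Finset.univ : Finset (Fin T)).piecewise A (B - A)) := by
    rw [Finset.piecewise_univ]
  rw [h, hu]
  refine Finset.single_le_sum (f := fun s : Finset (Fin T) => tensorOp (s.piecewise A (B - A)))
    (fun s _ => tensorOp_nonneg fun j => ?_) (Finset.mem_univ _)
  by_cases hj : j ∈ s
  · simpa [Finset.piecewise, hj] using hA j
  · simpa [Finset.piecewise, hj] using hAB j

/-- The product vector `φ ⊗ ⋯ ⊗ φ`. -/
def tensorVec (T : ℕ) (φ : (Q → Fin 2) → ℂ) : (Fin T × Q → Fin 2) → ℂ :=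
  fun x => ∏ j : Fin T, φ (fun q => x (j, q))

theorem dotProduct_tensorOp_mulVec (A : Fin T → QubitOp Q) (φ : (Q → Fin 2) → ℂ) :
    star (tensorVec T φ) ⬝ᵥ (tensorOp A).mulVec (tensorVec T φ) =
      ∏ j, star φ ⬝ᵥ (A j).mulVec φ := by
  have h1 : (tensorOp A).mulVec (tensorVec T φ) =
      fun x => ∏ j, (A j).mulVec φ (fun q => x (j, q)) := by
    funext x
    simp only [Matrix.mulVec, dotProduct, tensorOp, tensorVec, Matrix.of_apply,
      Finset.prod_univ_sum, Fintype.piFinset_univ, ← Finset.prod_mul_distrib]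
    exact Fintype.sum_equiv (Equiv.curry (Fin T) Q (Fin 2)) _ _ (fun z => rfl)
  rw [h1]
  simp only [dotProduct, tensorVec, Pi.star_apply, star_prod,
    Finset.prod_univ_sum, Fintype.piFinset_univ, ← Finset.prod_mul_distrib]
  exact Fintype.sum_equiv (Equiv.curry (Fin T) Q (Fin 2)) _ _ (fun z => rfl)

theorem prefixOp_mono {A A' B : QubitOp Q} (hA : 0 ≤ A) (hAA' : A ≤ A') (hB : 0 ≤ B)
    (k : Fin T) : prefixOp A B k ≤ prefixOp A' B k := by
  have h1 : (0 : QubitOp Q) ≤ 1 := Matrix.nonneg_iff_posSemidef.mpr Matrix.PosSemidef.one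
  refine tensorOp_mono (fun j => ?_) (fun j => ?_)
  · split_ifs
    exacts [hA, hB, h1]
  · split_ifs
    exacts [hAA', le_rfl, le_rfl]

/-- A union bound for the failure of tensor powers. -/
theorem one_sub_tensorOp_sum_le {ι : Type*} [Fintype ι] (Z : ι → QubitOp Q) (hZ : ∀ χ, 0 ≤ Z χ)
    (hZ1 : ∑ χ, Z χ ≤ 1) :
    1 - tensorOp (fun _ : Fin T => 1 - ∑ χ, Z χ) ≤
      ∑ χ, (1 - tensorOp (fun _ : Fin T => 1 - Z χ)) := by
  simp only [one_sub_tensorOp_const]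
  rw [Finset.sum_comm]
  refine Finset.sum_le_sum fun k _ => ?_
  rw [prefixOp_sum]
  -- After telescoping and splitting the marked register by linearity, only the prefix has to grow,
  -- from `1 - ∑ Z` to `1 - Z χ`. No commutation between the `Z χ` is needed.
  refine Finset.sum_le_sum fun χ _ => prefixOp_mono (sub_nonneg.mpr hZ1) ?_ (hZ χ) k
  exact sub_le_sub_left (Finset.single_le_sum (fun i _ => hZ i) (Finset.mem_univ χ)) _

end TensorOp

/-! ### The lowest eigenvalue and the operator order. -/

section LambdaMin

open scoped ComplexOrder MatrixOrder

variable {Q : Type} [Fintype Q] [DecidableEq Q] {A : QubitOp Q}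

theorem spectrum_sub_real_smul_one (A : QubitOp Q) (c r : ℝ) :
    r ∈ spectrum ℝ (A - (c : ℂ) • (1 : QubitOp Q)) ↔ r + c ∈ spectrum ℝ A := by
  have h : A = (A - (c : ℂ) • (1 : QubitOp Q)) + algebraMap ℝ (QubitOp Q) c := by
    rw [Algebra.algebraMap_eq_smul_one, ← Complex.coe_smul, sub_add_cancel]
  conv_rhs => rw [h]
  rw [add_comm (A - _), spectrum.add_mem_iff]
  simp

theorem smul_one_le_iff (hA : A.IsHermitian) (c : ℝ) :
    (c : ℂ) • (1 : QubitOp Q) ≤ A ↔ ∀ r ∈ spectrum ℝ A, c ≤ r := by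
  have hH : (A - (c : ℂ) • (1 : QubitOp Q)).IsHermitian := by
    refine hA.sub ?_
    rw [Complex.coe_smul]
    exact Matrix.isHermitian_one.smul (IsSelfAdjoint.all c)
  rw [Matrix.le_iff, hH.posSemidef_iff_eigenvalues_nonneg]
  constructor
  · intro h r hr
    have : r - c ∈ spectrum ℝ (A - (c : ℂ) • (1 : QubitOp Q)) := by
      rw [spectrum_sub_real_smul_one]; simpa using hr
    rw [hH.spectrum_real_eq_range_eigenvalues] at this
    obtain ⟨i, hi⟩ := this
    have := h i
    simp only [Pi.zero_apply] at this
    linarith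
  · intro h i
    have := h _ ((spectrum_sub_real_smul_one A c _).mp (hH.eigenvalues_mem_spectrum_real i))
    simp only [Pi.zero_apply]
    linarith

theorem lambdaMin_mem_spectrum (hA : A.IsHermitian) : lambdaMin A ∈ spectrum ℝ A := by
  rw [lambdaMin, hA.spectrum_real_eq_range_eigenvalues]
  exact (Set.range_nonempty _).csInf_mem (Set.finite_range _)

theorem lambdaMin_smul_one_le (hA : A.IsHermitian) :
    (lambdaMin A : ℂ) • (1 : QubitOp Q) ≤ A := by
  rw [smul_one_le_iff hA]
  intro r hr
  refine csInf_le ?_ hr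
  rw [hA.spectrum_real_eq_range_eigenvalues]
  exact (Set.finite_range _).bddBelow

theorem le_lambdaMin (hA : A.IsHermitian) {c : ℝ} (h : (c : ℂ) • (1 : QubitOp Q) ≤ A) :
    c ≤ lambdaMin A :=
  (smul_one_le_iff hA c).mp h _ (lambdaMin_mem_spectrum hA)

theorem exists_lambdaMin_eigenvector (hA : A.IsHermitian) :
    ∃ φ : (Q → Fin 2) → ℂ, star φ ⬝ᵥ φ = 1 ∧ star φ ⬝ᵥ A.mulVec φ = lambdaMin A := by
  have h := lambdaMin_mem_spectrum hA
  rw [hA.spectrum_real_eq_range_eigenvalues] at h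
  obtain ⟨i, hi⟩ := h
  have h1 : star (⇑(hA.eigenvectorBasis i)) ⬝ᵥ ⇑(hA.eigenvectorBasis i) = 1 := by
    have := hA.eigenvectorBasis.orthonormal.1 i
    have h2 := inner_self_eq_norm_sq_to_K (𝕜 := ℂ) (hA.eigenvectorBasis i)
    rw [this, EuclideanSpace.inner_eq_star_dotProduct] at h2
    rw [dotProduct_comm]
    simpa using h2
  refine ⟨hA.eigenvectorBasis i, h1, ?_⟩
  rw [hA.mulVec_eigenvectorBasis, hi, dotProduct_smul, h1]
  simp

end LambdaMin

/-! ### Joint measurement of commuting projections. -/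

section JointResolution

open scoped IsMulCommutative

/-- Pairwise commuting projections have a joint resolution of the identity: projections `P S`,
indexed by the sets `S` of the given projections, such that `p i` is the sum of those `P S` with
`i ∈ S`. -/
theorem exists_joint_resolution {ι A : Type*} [Fintype ι] [DecidableEq ι] [Ring A] [StarRing A]
    [Algebra ℂ A] [StarModule ℂ A] (p : ι → A) (hp : ∀ i, IsStarProjection (p i))
    (hc : ∀ i j, Commute (p i) (p j)) :
    ∃ P : Finset ι → A, (∀ S, IsStarProjection (P S)) ∧ ∑ S, P S = 1 ∧
      ∀ i, ∑ S with i ∈ S, P S = p i := by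
  have hc1 : ∀ a ∈ Set.range p, ∀ b ∈ Set.range p, a * b = b * a := by
    rintro _ ⟨i, rfl⟩ _ ⟨j, rfl⟩
    exact hc i j
  have hc2 : ∀ a ∈ Set.range p, ∀ b ∈ Set.range p, a * star b = star b * a := by
    rintro _ ⟨i, rfl⟩ _ ⟨j, rfl⟩
    rw [(hp j).isSelfAdjoint.star_eq]
    exact hc i j
  -- Passing to the commutative star algebra generated by the projections makes unordered products
  -- available.
  have := StarAlgebra.isMulCommutative_adjoin ℂ hc1 hc2
  let q : ι → StarAlgebra.adjoin ℂ (Set.range p) := fun i =>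
    ⟨p i, StarAlgebra.subset_adjoin ℂ _ ⟨i, rfl⟩⟩
  have hqi : ∀ i, q i * q i = q i := fun i => Subtype.ext (hp i).isIdempotentElem
  have hqs : ∀ i, star (q i) = q i := fun i => Subtype.ext (hp i).isSelfAdjoint.star_eq
  let R : Finset ι → StarAlgebra.adjoin ℂ (Set.range p) := fun S =>
    (∏ i ∈ S, q i) * ∏ i ∈ Finset.univ \ S, (1 - q i)
  -- Expand `∏ (q i + (1 - q i)) = 1` over subsets.
  have hR1 : ∑ S, R S = 1 := by
    have := Finset.prod_add q (fun i => 1 - q i) Finset.univ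
    simp only [add_sub_cancel, Finset.prod_const_one, Finset.powerset_univ] at this
    exact this.symm
  have hRmul : ∀ i S, q i * R S = if i ∈ S then R S else 0 := by
    intro i S
    split_ifs with h
    · simp only [R]
      rw [← Finset.mul_prod_erase S q h, ← mul_assoc, ← mul_assoc, hqi]
    · have h' : i ∈ Finset.univ \ S := by simp [h]
      simp only [R]
      rw [← Finset.mul_prod_erase _ (fun i => 1 - q i) h', mul_left_comm, ← mul_assoc (q i),
        mul_sub, mul_one, hqi, sub_self, zero_mul, mul_zero]
  have hRi : ∀ i, ∑ S with i ∈ S, R S = q i := by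
    intro i
    rw [← mul_one (q i), ← hR1, Finset.mul_sum, Finset.sum_filter]
    exact Finset.sum_congr rfl fun S _ => (hRmul i S).symm
  have hRs : ∀ S, star (R S) = R S := by
    intro S
    simp only [R, star_mul', star_prod, star_sub, star_one, hqs]
  have hRR : ∀ S, R S * R S = R S := by
    intro S
    simp only [R]
    rw [mul_mul_mul_comm, ← Finset.prod_mul_distrib, ← Finset.prod_mul_distrib]
    congr 1
    · exact Finset.prod_congr rfl fun i _ => hqi i
    · refine Finset.prod_congr rfl fun i _ => ?_
      rw [mul_sub, sub_mul, sub_mul, hqi]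
      simp
  refine ⟨fun S => (R S : A), fun S => ⟨congrArg Subtype.val (hRR S), congrArg Subtype.val (hRs S)⟩,
    ?_, fun i => ?_⟩
  · have := congrArg (StarSubalgebra.subtype _) hR1
    rwa [map_sum, map_one] at this
  · have := congrArg (StarSubalgebra.subtype _) (hRi i)
    rwa [map_sum] at this

end JointResolution

/-! ### The constant `C_μ`. -/

section WalkConst

variable {μ : ℝ}

theorem hasSum_pow_natAbs_sub (h0 : 0 ≤ μ) (h1 : μ < 1) (i : ℤ) :
    HasSum (fun j : ℤ => μ ^ (j - i).natAbs) ((1 - μ)⁻¹ + (1 - μ)⁻¹ * μ) := by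
  have hg := hasSum_geometric_of_lt_one h0 h1
  have h : HasSum (fun j : ℤ => μ ^ j.natAbs) ((1 - μ)⁻¹ + (1 - μ)⁻¹ * μ) := by
    refine HasSum.of_nat_of_neg_add_one (by simpa using hg) ?_
    have h2 : (fun n : ℕ => μ ^ (-((n : ℤ) + 1)).natAbs) = fun n => μ ^ n * μ := by
      funext n
      rw [← pow_succ]
      congr 1
    rw [h2]
    exact hg.mul_right μ
  simpa only [Function.comp_def, Equiv.subRight_apply] using (Equiv.subRight i).hasSum_iff.mpr h

theorem tsum_pow_natAbs_sub_le (h0 : 0 ≤ μ) (h1 : μ < 1) (i : ℤ) :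
    ∑' j : {j : ℤ // j ≠ i}, μ ^ ((j : ℤ) - i).natAbs ≤ 2 / (1 - μ) := by
  have h := hasSum_pow_natAbs_sub h0 h1 i
  have hle := h.summable.tsum_subtype_le (fun j : ℤ => μ ^ (j - i).natAbs) {j | j ≠ i}
    (fun j => by positivity)
  rw [h.tsum_eq] at hle
  refine hle.trans ?_
  have : 0 < 1 - μ := by linarith
  rw [div_eq_mul_inv]
  have h3 : 0 < (1 - μ)⁻¹ := inv_pos.mpr this
  nlinarith

theorem walkConst_le (h0 : 0 ≤ μ) (h1 : μ < 1) : walkConst μ ≤ 2 / (1 - μ) :=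
  ciSup_le fun i => tsum_pow_natAbs_sub_le h0 h1 i

theorem sum_pow_natAbs_le_walkConst (h0 : 0 ≤ μ) (h1 : μ < 1) {T : ℕ} (i : Fin T) :
    ∑ j with j ≠ i, μ ^ ((j : ℤ) - (i : ℤ)).natAbs ≤ walkConst μ := by
  -- Boundedness matters: a real supremum over an unbounded range would default to `0`.
  have hb : BddAbove (Set.range fun i : ℤ =>
      ∑' j : {j : ℤ // j ≠ i}, μ ^ ((j : ℤ) - i).natAbs) :=
    ⟨_, Set.forall_mem_range.mpr fun i => tsum_pow_natAbs_sub_le h0 h1 i⟩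
  refine le_trans ?_ (le_ciSup hb (i : ℤ))
  let e : {j : Fin T // j ≠ i} ↪ {j : ℤ // j ≠ (i : ℤ)} :=
    ⟨fun j => ⟨(j.1 : ℤ), fun h => j.2 (Fin.ext (by exact_mod_cast h))⟩, fun a b h => by
      simp only [Subtype.mk.injEq, Nat.cast_inj] at h
      exact Subtype.ext (Fin.ext h)⟩
  have hs : Summable fun j : {j : ℤ // j ≠ (i : ℤ)} => μ ^ ((j : ℤ) - i).natAbs :=
    (hasSum_pow_natAbs_sub h0 h1 i).summable.subtype _
  have := hs.sum_le_tsum (Finset.univ.map e) (fun j _ => by positivity)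
  refine le_trans (le_of_eq ?_) this
  rw [Finset.sum_map, Finset.sum_subtype (p := fun j => j ≠ i) _ (by simp)]
  rfl

theorem walkConst_nonneg (μ : ℝ) (h0 : 0 ≤ μ) : 0 ≤ walkConst μ :=
  Real.iSup_nonneg fun i => tsum_nonneg fun j => by positivity

end WalkConst

/-! ### Expander mixing and sums over walks. -/

namespace RegularGraph

variable {V : Type} [Fintype V] {d : ℕ} (G : RegularGraph V d)

/-- The adjacency matrix with real entries. -/
def realAdj : Matrix V V ℝ := G.adj.map (fun a : ℕ => (a : ℝ))

theorem realAdj_mulVec_const (c : ℝ) : G.realAdj.mulVec (fun _ => c) = fun _ => d * c := by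
  funext v
  simp only [Matrix.mulVec, dotProduct, realAdj, Matrix.map_apply]
  rw [← Finset.sum_mul, ← Nat.cast_sum, G.regular]

theorem realAdj_transpose : G.realAdj.transpose = G.realAdj := by
  ext u v
  simp [realAdj, G.symm.apply u v]

theorem dotProduct_realAdj_mulVec (x y : V → ℝ) :
    x ⬝ᵥ G.realAdj.mulVec y = G.realAdj.mulVec x ⬝ᵥ y := by
  rw [Matrix.dotProduct_mulVec, ← Matrix.mulVec_transpose, realAdj_transpose]

theorem sum_realAdj_mulVec (y : V → ℝ) : ∑ v, G.realAdj.mulVec y v = d * ∑ v, y v := by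
  have := G.dotProduct_realAdj_mulVec (fun _ => 1) y
  rw [realAdj_mulVec_const] at this
  simpa [dotProduct, Finset.mul_sum] using this

section Spectral

variable [DecidableEq V] [Nonempty V] {lam : ℝ}

open Classical in
/-- The expander mixing inequality for walks of length `k`. -/
theorem dotProduct_realAdj_pow_mulVec_le (hlam0 : 0 ≤ lam) (hlam : lam < d)
    (hG : G.IsSpectralExpander lam) (k : ℕ) (x y : V → ℝ) :
    x ⬝ᵥ (G.realAdj ^ k).mulVec y ≤
      d ^ k * ((∑ v, x v) * ∑ v, y v) / Fintype.card V +
        lam ^ k * ((x ⬝ᵥ x + y ⬝ᵥ y) / 2) := by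
  have hH : G.realAdj.IsHermitian := G.isHermitian_adj
  let b : V → V → ℝ := fun i => hH.eigenvectorBasis i
  have hparseval : ∀ x y : V → ℝ, ∑ i, (b i ⬝ᵥ x) * (b i ⬝ᵥ y) = x ⬝ᵥ y := by
    intro x y
    have := hH.eigenvectorBasis.sum_inner_mul_inner (WithLp.toLp 2 x) (WithLp.toLp 2 y)
    simp only [EuclideanSpace.inner_eq_star_dotProduct] at this
    simp only [star_trivial] at this
    rw [dotProduct_comm x y, ← this]
    exact Finset.sum_congr rfl fun i _ => by rw [dotProduct_comm y]
  have hbA : ∀ i, G.realAdj.mulVec (b i) = hH.eigenvalues i • b i := fun i =>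
    hH.mulVec_eigenvectorBasis i
  have hcoef : ∀ i y, b i ⬝ᵥ G.realAdj.mulVec y = hH.eigenvalues i * (b i ⬝ᵥ y) := by
    intro i y
    rw [dotProduct_realAdj_mulVec, hbA, smul_dotProduct, smul_eq_mul]
  have hcoefk : ∀ (k : ℕ) i y,
      b i ⬝ᵥ (G.realAdj ^ k).mulVec y = hH.eigenvalues i ^ k * (b i ⬝ᵥ y) := by
    intro k
    induction k with
    | zero => simp
    | succ k ih =>
      intro i y
      rw [pow_succ, ← Matrix.mulVec_mulVec, ih, hcoef]
      ring
  have hm : (0 : ℝ) < Fintype.card V := by exact_mod_cast Fintype.card_pos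
  -- This is the reindexing by which `eigenvalues` is defined from the ordered list `eigenvalues₀`,
  -- so `i₀` labels the largest eigenvalue.
  let e : Fin (Fintype.card V) ≃ V := Fintype.equivOfCardEq (Fintype.card_fin _)
  let i₀ : V := e ⟨0, Fintype.card_pos⟩
  have hbound : ∀ i, i ≠ i₀ → |hH.eigenvalues i| ≤ lam := by
    intro i hi
    refine hG (e.symm i) fun h => hi ?_
    rw [← e.apply_symm_apply i]
    exact congrArg e (Fin.ext h)
  let one : V → ℝ := fun _ => 1
  have hone : ∀ i, hH.eigenvalues i * (b i ⬝ᵥ one) = d * (b i ⬝ᵥ one) := by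
    intro i
    rw [← hcoef, realAdj_mulVec_const]
    simp [dotProduct, one, Finset.mul_sum, mul_comm]
  -- The all-ones vector has eigenvalue `d > lam`, so it is orthogonal to every eigenvector other
  -- than `b i₀`. The `i₀` component therefore supplies the main term.
  have hone0 : ∀ i, i ≠ i₀ → b i ⬝ᵥ one = 0 := by
    intro i hi
    by_contra h
    have h1 := mul_right_cancel₀ h (hone i)
    have h2 := (le_abs_self _).trans (hbound i hi)
    linarith
  have hsingle : ∀ x : V → ℝ, (b i₀ ⬝ᵥ one) * (b i₀ ⬝ᵥ x) = ∑ v, x v := by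
    intro x
    have := hparseval one x
    rw [Finset.sum_eq_single i₀ (fun i _ hi => by rw [hone0 i hi, zero_mul]) (by simp)] at this
    rw [this]
    simp [dotProduct, one]
  have hcsq : (b i₀ ⬝ᵥ one) * (b i₀ ⬝ᵥ one) = Fintype.card V := by
    rw [hsingle]
    simp [one]
  have hc0 : b i₀ ⬝ᵥ one ≠ 0 := fun h => by
    rw [h, zero_mul] at hcsq
    exact hm.ne hcsq
  have hl0 : hH.eigenvalues i₀ = d := mul_right_cancel₀ hc0 (hone i₀)
  have hmain : d ^ k * ((∑ v, x v) * ∑ v, y v) / Fintype.card V =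
      hH.eigenvalues i₀ ^ k * ((b i₀ ⬝ᵥ x) * (b i₀ ⬝ᵥ y)) := by
    rw [hl0, ← hsingle x, ← hsingle y, ← hcsq]
    field_simp
  have hterm : ∀ i, i ≠ i₀ → hH.eigenvalues i ^ k * ((b i ⬝ᵥ x) * (b i ⬝ᵥ y)) ≤
      lam ^ k * (((b i ⬝ᵥ x) * (b i ⬝ᵥ x) + (b i ⬝ᵥ y) * (b i ⬝ᵥ y)) / 2) := by
    intro i hi
    refine (le_abs_self _).trans ?_
    rw [abs_mul, abs_pow]
    refine mul_le_mul (pow_le_pow_left₀ (abs_nonneg _) (hbound i hi) k) ?_ (abs_nonneg _)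
      (by positivity)
    rw [abs_le]
    constructor
    · nlinarith [sq_nonneg (b i ⬝ᵥ x + b i ⬝ᵥ y)]
    · nlinarith [sq_nonneg (b i ⬝ᵥ x - b i ⬝ᵥ y)]
  rw [← hparseval x ((G.realAdj ^ k).mulVec y), ← hparseval x x, ← hparseval y y, hmain,
    ← Finset.sum_add_distrib, Finset.sum_div, Finset.mul_sum,
    ← Finset.add_sum_erase _ _ (Finset.mem_univ i₀)]
  refine add_le_add ?_ ?_
  · rw [hcoefk]
    exact le_of_eq (by ring)
  · refine (Finset.sum_le_sum fun i hi => ?_).trans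
      (Finset.sum_le_univ_sum_of_nonneg (s := Finset.univ.erase i₀) fun i => ?_)
    · rw [hcoefk]
      exact le_trans (le_of_eq (by ring)) (hterm i (Finset.ne_of_mem_erase hi))
    · have := mul_self_nonneg (b i ⬝ᵥ x)
      have := mul_self_nonneg (b i ⬝ᵥ y)
      positivity

end Spectral

section WalkSum

/-- The sum of `F` over the walks with `n + 1` vertices. -/
def walkSum (n : ℕ) (F : (Fin (n + 1) → V) → ℝ) : ℝ :=
  ∑ f : Fin (n + 1) → V, (∏ j : Fin n, (G.adj (f j.castSucc) (f j.succ) : ℝ)) * F f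

/-- Parallel edges are chosen independently at each step, so a vertex sequence is counted with the
product of its edge multiplicities. -/
theorem sum_path_eq_walkSum (n : ℕ) (F : (Fin (n + 1) → V) → ℝ) :
    ∑ p : G.Path (n + 1), F p.vertex = G.walkSum n F := by
  have h := Fintype.sum_sigma (α := fun f : Fin (n + 1) → V => ∀ j : Fin n,
    Fin (G.adj (f j.castSucc) (f j.succ))) (fun p => F p.1)
  refine Eq.trans h (Finset.sum_congr rfl fun f _ => ?_)
  simp

theorem walkSum_const_mul (n : ℕ) (c : ℝ) (F : (Fin (n + 1) → V) → ℝ) :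
    G.walkSum n (fun f => c * F f) = c * G.walkSum n F := by
  simp only [walkSum, Finset.mul_sum]
  exact Finset.sum_congr rfl fun f _ => by ring

/-- Summing out the last vertex applies the adjacency matrix to `y`. The moment formulas below
follow by iterating this. -/
theorem walkSum_succ (n : ℕ) (φ : (Fin (n + 1) → V) → ℝ) (y : V → ℝ) :
    G.walkSum (n + 1) (fun f => φ (fun j => f j.castSucc) * y (f (Fin.last _))) =
      G.walkSum n (fun f => φ f * G.realAdj.mulVec y (f (Fin.last _))) := by
  simp only [walkSum]
  rw [← (Fin.snocEquiv (fun _ : Fin (n + 2) => V)).sum_comp, Fintype.sum_prod_type_right]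
  refine Finset.sum_congr rfl fun f _ => ?_
  simp only [Matrix.mulVec, dotProduct, Finset.mul_sum, Fin.snocEquiv_apply]
  refine Finset.sum_congr rfl fun v _ => ?_
  simp only [Fin.prod_univ_castSucc, Fin.snoc_castSucc, Fin.succ_last, Fin.snoc_last,
    ← Fin.castSucc_succ, realAdj, Matrix.map_apply]
  ring

theorem walkSum_last (n : ℕ) (x : V → ℝ) :
    G.walkSum n (fun f => x (f (Fin.last _))) = d ^ n * ∑ v, x v := by
  induction n generalizing x with
  | zero =>
    simp only [walkSum, Finset.univ_eq_empty, Finset.prod_empty, one_mul, pow_zero]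
    exact (Equiv.funUnique (Fin 1) V).sum_comp x
  | succ n ih =>
    have := G.walkSum_succ n (fun _ => 1) x
    simp only [one_mul] at this
    rw [this, ih, sum_realAdj_mulVec]
    ring

theorem walkSum_castSucc (n : ℕ) (φ : (Fin (n + 1) → V) → ℝ) :
    G.walkSum (n + 1) (fun f => φ (fun j => f j.castSucc)) = d * G.walkSum n φ := by
  have := G.walkSum_succ n φ (fun _ => 1)
  simp only [mul_one, realAdj_mulVec_const] at this
  rw [this, ← walkSum_const_mul]
  simp only [mul_comm]

theorem walkSum_vertex (n : ℕ) (i : Fin (n + 1)) (x : V → ℝ) :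
    G.walkSum n (fun f => x (f i)) = d ^ n * ∑ v, x v := by
  induction n with
  | zero =>
    obtain rfl : i = Fin.last 0 := Fin.ext (by omega)
    exact G.walkSum_last 0 x
  | succ n ih =>
    cases i using Fin.lastCases with
    | last => exact G.walkSum_last _ x
    | cast i =>
      rw [G.walkSum_castSucc n (fun f => x (f i)), ih]
      ring

variable [DecidableEq V]

/-- Steps after `j` or before `i` each contribute a factor `d` by regularity; the `j - i` steps
between contribute the matrix power. -/
theorem walkSum_pair (n : ℕ) (i j : Fin (n + 1)) (hij : i ≤ j) (x y : V → ℝ) :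
    G.walkSum n (fun f => x (f i) * y (f j)) =
      d ^ (n - (j - i : ℕ)) * (x ⬝ᵥ (G.realAdj ^ (j - i : ℕ)).mulVec y) := by
  induction n generalizing y with
  | zero =>
    obtain rfl : i = j := Fin.ext (by omega)
    rw [G.walkSum_vertex 0 i (fun v => x v * y v)]
    simp [dotProduct]
  | succ n ih =>
    cases i using Fin.lastCases with
    | last =>
      obtain rfl : j = Fin.last _ := Fin.last_le_iff.mp hij
      rw [G.walkSum_last _ (fun v => x v * y v)]
      simp [dotProduct]
    | cast i =>
      cases j using Fin.lastCases with
      | last =>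
        rw [G.walkSum_succ n (fun f => x (f i)) y, ih i (Fin.last n) (Fin.le_last i)]
        have hi : (i : ℕ) ≤ n := Nat.lt_succ_iff.mp i.2
        simp only [Fin.val_last, Fin.val_castSucc]
        rw [Matrix.mulVec_mulVec, ← pow_succ, Nat.sub_add_comm hi,
          show n - (n - (i : ℕ)) = n + 1 - (n - i + 1) by omega]
      | cast j =>
        rw [G.walkSum_castSucc n (fun f => x (f i) * y (f j)), ih i j (by simpa using hij)]
        simp only [Fin.val_castSucc]
        have hj : (j : ℕ) ≤ n := Nat.lt_succ_iff.mp j.2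
        rw [show n + 1 - ((j : ℕ) - i) = n - (j - i) + 1 by omega]
        ring

end WalkSum

theorem card_path (T : ℕ) (hT : 1 ≤ T) :
    Fintype.card (G.Path T) = d ^ (T - 1) * Fintype.card V := by
  obtain ⟨n, rfl⟩ := Nat.exists_eq_add_of_le' hT
  have h := G.sum_path_eq_walkSum n (fun _ => 1)
  rw [G.walkSum_vertex n 0 (fun _ => 1)] at h
  simp only [Finset.sum_const, Finset.card_univ, nsmul_eq_mul, mul_one] at h
  simpa using (by exact_mod_cast h : Fintype.card (G.Path (n + 1)) = d ^ n * Fintype.card V)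

end RegularGraph

/-! ### Hitting probabilities of random walks. -/

theorem one_sub_le_prod_one_sub {ι : Type*} (s : Finset ι) (x : ι → ℝ) (h0 : ∀ i ∈ s, 0 ≤ x i)
    (h1 : ∀ i ∈ s, x i ≤ 1) : 1 - ∑ i ∈ s, x i ≤ ∏ i ∈ s, (1 - x i) := by
  classical
  induction s using Finset.induction_on with
  | empty => simp
  | insert i s hi ih =>
    have ih := ih (fun j hj => h0 j (Finset.mem_insert_of_mem hj))
      (fun j hj => h1 j (Finset.mem_insert_of_mem hj))
    have h2 := Finset.sum_nonneg fun j hj => h0 j (Finset.mem_insert_of_mem hj : j ∈ insert i s)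
    rw [Finset.sum_insert hi, Finset.prod_insert hi]
    have h3 := h0 i (Finset.mem_insert_self i s)
    have h4 := h1 i (Finset.mem_insert_self i s)
    nlinarith [mul_le_mul_of_nonneg_left ih (sub_nonneg.mpr h4)]

theorem le_mul_of_sq_le {N a C p : ℝ} (hN : 0 < N) (ha : 0 ≤ a) (hC : 0 ≤ C) (hp : 0 ≤ p)
    (h : (N * a) ^ 2 ≤ N * p * (N * (a + a ^ 2 + C * a))) : a ≤ p * (1 + C + a) := by
  rcases ha.eq_or_lt with rfl | ha
  · positivity
  · refine le_of_mul_le_mul_left (a := N ^ 2 * a) ?_ (by positivity)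
    linarith

namespace RegularGraph

variable {V : Type} [Fintype V] {d : ℕ} (G : RegularGraph V d) {T : ℕ}

theorem card_path_pos [NeZero d] [Nonempty V] (T : ℕ) : (0 : ℝ) < Fintype.card (G.Path T) := by
  exact_mod_cast Fintype.card_pos

variable [DecidableEq V]

/-- The fraction of the paths that meet the sets `S j` at one of the times `j`. -/
noncomputable def hitProb (S : Fin T → Finset V) : ℝ :=
  (∑ p : G.Path T, if ∃ j, p.vertex j ∈ S j then (1 : ℝ) else 0) / Fintype.card (G.Path T)

/-- By regularity, every vertex of a uniformly random path is uniformly distributed. -/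
theorem sum_path_vertex_mem [Nonempty V] (j : Fin T) (S : Finset V) :
    ∑ p : G.Path T, (if p.vertex j ∈ S then (1 : ℝ) else 0) =
      Fintype.card (G.Path T) * (S.card / Fintype.card V) := by
  have hm : (0 : ℝ) < Fintype.card V := by exact_mod_cast Fintype.card_pos
  rw [G.card_path T (by have := j.2; omega)]
  obtain ⟨n, rfl⟩ := Nat.exists_eq_add_of_le' (show 1 ≤ T by have := j.2; omega)
  rw [G.sum_path_eq_walkSum n (fun f => if f j ∈ S then (1 : ℝ) else 0),
    G.walkSum_vertex n j (fun v => if v ∈ S then (1 : ℝ) else 0)]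
  simp only [Finset.sum_boole, Finset.filter_univ_mem, Nat.add_sub_cancel, Nat.cast_mul, Nat.cast_pow]
  field_simp

variable [NeZero d] [Nonempty V]

theorem hitProb_le_sum (S : Fin T → Finset V) :
    G.hitProb S ≤ ∑ j, ((S j).card : ℝ) / Fintype.card V := by
  rw [hitProb, div_le_iff₀ (G.card_path_pos T), mul_comm, Finset.mul_sum]
  rw [← Finset.sum_congr rfl fun j _ => G.sum_path_vertex_mem j (S j), Finset.sum_comm]
  refine Finset.sum_le_sum fun p _ => ?_
  have h0 : ∀ j ∈ Finset.univ, (0 : ℝ) ≤ if p.vertex j ∈ S j then (1 : ℝ) else 0 :=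
    fun j _ => by positivity
  split_ifs with h
  · obtain ⟨j, hj⟩ := h
    have := Finset.single_le_sum h0 (Finset.mem_univ j)
    rwa [if_pos hj] at this
  · exact Finset.sum_nonneg h0

theorem le_hitProb (S : Fin T → Finset V) (j : Fin T) :
    ((S j).card : ℝ) / Fintype.card V ≤ G.hitProb S := by
  rw [hitProb, le_div_iff₀ (G.card_path_pos T), mul_comm, ← G.sum_path_vertex_mem j]
  refine Finset.sum_le_sum fun p _ => ?_
  by_cases h : p.vertex j ∈ S j
  · rw [if_pos h, if_pos ⟨j, h⟩]
  · rw [if_neg h]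
    positivity

theorem hitProb_nonneg (S : Fin T → Finset V) : 0 ≤ G.hitProb S :=
  div_nonneg (Finset.sum_nonneg fun p _ => by positivity) (G.card_path_pos T).le

theorem sum_path_pair_mem_le {lam : ℝ} (hlam0 : 0 ≤ lam) (hlam : lam < d)
    (hG : G.IsSpectralExpander lam) {i j : Fin T} (hij : i ≤ j) (S S' : Finset V) :
    ∑ p : G.Path T, (if p.vertex i ∈ S then (1 : ℝ) else 0) * (if p.vertex j ∈ S' then 1 else 0) ≤
      Fintype.card (G.Path T) * (S.card / Fintype.card V * (S'.card / Fintype.card V) +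
        (lam / d) ^ (j - i : ℕ) *
          ((S.card / Fintype.card V + S'.card / Fintype.card V) / 2)) := by
  have hm : (0 : ℝ) < Fintype.card V := by exact_mod_cast Fintype.card_pos
  have hd : (0 : ℝ) < d := by exact_mod_cast Nat.pos_of_ne_zero (NeZero.ne d)
  rw [G.card_path T (by have := j.2; omega)]
  obtain ⟨n, rfl⟩ := Nat.exists_eq_add_of_le' (show 1 ≤ T by have := j.2; omega)
  have hle : (j - i : ℕ) ≤ n := by have := j.2; omega
  rw [G.sum_path_eq_walkSum n
      (fun f => (if f i ∈ S then (1 : ℝ) else 0) * (if f j ∈ S' then 1 else 0)),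
    G.walkSum_pair n i j hij (fun v => if v ∈ S then (1 : ℝ) else 0)
      (fun v => if v ∈ S' then (1 : ℝ) else 0)]
  refine (mul_le_mul_of_nonneg_left
    (G.dotProduct_realAdj_pow_mulVec_le hlam0 hlam hG _ _ _) (by positivity)).trans (le_of_eq ?_)
  simp only [dotProduct, mul_ite, mul_one, mul_zero, ← ite_and, and_self, Finset.sum_boole,
    Finset.filter_univ_mem, Nat.add_sub_cancel, Nat.cast_mul, Nat.cast_pow]
  have hpow : (d : ℝ) ^ n = d ^ (n - (j - i : ℕ)) * d ^ (j - i : ℕ) := by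
    rw [← pow_add, Nat.sub_add_cancel hle]
  rw [hpow, div_pow]
  field_simp

theorem sum_path_pair_mem_le_natAbs {lam : ℝ} (hlam0 : 0 ≤ lam) (hlam : lam < d)
    (hG : G.IsSpectralExpander lam) (i j : Fin T) (S S' : Finset V) :
    ∑ p : G.Path T, (if p.vertex i ∈ S then (1 : ℝ) else 0) * (if p.vertex j ∈ S' then 1 else 0) ≤
      Fintype.card (G.Path T) * (S.card / Fintype.card V * (S'.card / Fintype.card V) +
        (lam / d) ^ ((j : ℤ) - (i : ℤ)).natAbs *
          ((S.card / Fintype.card V + S'.card / Fintype.card V) / 2)) := by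
  rcases le_total i j with h | h
  · have h1 : ((j : ℤ) - (i : ℤ)).natAbs = (j - i : ℕ) := by
      have : (i : ℕ) ≤ j := h
      omega
    rw [h1]
    exact G.sum_path_pair_mem_le hlam0 hlam hG h S S'
  · have h1 : ((j : ℤ) - (i : ℤ)).natAbs = (i - j : ℕ) := by
      have : (j : ℕ) ≤ i := h
      omega
    rw [h1]
    refine le_of_eq_of_le (Finset.sum_congr rfl fun p _ => mul_comm _ _)
      ((G.sum_path_pair_mem_le hlam0 hlam hG h S' S).trans (le_of_eq ?_))
    ring

/-- The second moment bound: a long walk on an expander avoids sets of total density `a` with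
probability at most `1 - a / (1 + C_μ + a)`. -/
theorem sum_le_hitProb_mul {lam : ℝ} (hlam0 : 0 ≤ lam) (hlam : lam < d)
    (hG : G.IsSpectralExpander lam) (S : Fin T → Finset V) :
    ∑ j, ((S j).card : ℝ) / Fintype.card V ≤ G.hitProb S *
      (1 + walkConst (lam / d) + ∑ j, ((S j).card : ℝ) / Fintype.card V) := by
  have hm : (0 : ℝ) < Fintype.card V := by exact_mod_cast Fintype.card_pos
  have hd : (0 : ℝ) < d := by exact_mod_cast Nat.pos_of_ne_zero (NeZero.ne d)
  have hN := G.card_path_pos T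
  set N : ℝ := (Fintype.card (G.Path T) : ℝ)
  set C := walkConst (lam / d) with hC
  have hμ0 : 0 ≤ lam / d := by positivity
  have hμ1 : lam / d < 1 := (div_lt_one hd).mpr hlam
  let ε : Fin T → ℝ := fun j => ((S j).card : ℝ) / Fintype.card V
  have hε : ∀ j, 0 ≤ ε j := fun j => by positivity
  let a : ℝ := ∑ j, ε j
  have ha0 : 0 ≤ a := Finset.sum_nonneg fun j _ => hε j
  change a ≤ G.hitProb S * (1 + C + a)
  let u : Fin T → G.Path T → ℝ := fun j p => if p.vertex j ∈ S j then 1 else 0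
  let X : G.Path T → ℝ := fun p => ∑ j, u j p
  let I : G.Path T → ℝ := fun p => if ∃ j, p.vertex j ∈ S j then 1 else 0
  have hI : ∑ p, I p = N * G.hitProb S := by
    rw [hitProb, mul_div_cancel₀ _ hN.ne']
  have hII : ∑ p, I p ^ 2 = N * G.hitProb S := by
    rw [← hI]
    exact Finset.sum_congr rfl fun p _ => by simp only [I]; split_ifs <;> norm_num
  have hIX : ∑ p, I p * X p = N * a := by
    have h1 : ∀ p, I p * X p = X p := by
      intro p
      by_cases h : ∃ j, p.vertex j ∈ S j
      · simp only [I, if_pos h, one_mul]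
      · have : X p = 0 := Finset.sum_eq_zero fun j _ => if_neg fun hj => h ⟨j, hj⟩
        rw [this, mul_zero]
    simp only [h1, X, a, Finset.mul_sum]
    rw [Finset.sum_comm]
    exact Finset.sum_congr rfl fun j _ => G.sum_path_vertex_mem j (S j)
  -- The kernel is symmetric in `i` and `j`, so both halves of the average have the same sum, and
  -- `C` bounds each row of the kernel.
  have hsym : ∑ i : Fin T, ∑ j with j ≠ i, (lam / d) ^ ((j : ℤ) - (i : ℤ)).natAbs * ((ε i + ε j) / 2) ≤
      C * a := by
    have h1 : ∀ i : Fin T, ∑ j with j ≠ i, (lam / d) ^ ((j : ℤ) - (i : ℤ)).natAbs * (ε i / 2) ≤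
        C * (ε i / 2) := fun i => by
      rw [← Finset.sum_mul]
      exact mul_le_mul_of_nonneg_right (sum_pow_natAbs_le_walkConst hμ0 hμ1 i)
        (by have := hε i; positivity)
    have h2 : ∑ i : Fin T, ∑ j with j ≠ i,
        (lam / d) ^ ((j : ℤ) - (i : ℤ)).natAbs * (ε j / 2) =
        ∑ i : Fin T, ∑ j with j ≠ i,
          (lam / d) ^ ((j : ℤ) - (i : ℤ)).natAbs * (ε i / 2) := by
      simp only [Finset.sum_filter]
      rw [Finset.sum_comm]
      refine Finset.sum_congr rfl fun i _ => Finset.sum_congr rfl fun j _ => ?_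
      simp only [ne_comm (a := i), ne_eq, ← Int.natAbs_neg ((i : ℤ) - j), neg_sub]
    calc _ = ∑ i : Fin T, ∑ j with j ≠ i,
          (lam / d) ^ ((j : ℤ) - (i : ℤ)).natAbs * (ε i / 2) +
        ∑ i : Fin T, ∑ j with j ≠ i,
          (lam / d) ^ ((j : ℤ) - (i : ℤ)).natAbs * (ε j / 2) := by
          simp only [← Finset.sum_add_distrib]
          exact Finset.sum_congr rfl fun i _ => Finset.sum_congr rfl fun j _ => by ring
      _ ≤ ∑ i, C * (ε i / 2) + ∑ i, C * (ε i / 2) := by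
          rw [h2]
          exact add_le_add (Finset.sum_le_sum fun i _ => h1 i)
            (Finset.sum_le_sum fun i _ => h1 i)
      _ = C * a := by
          rw [← Finset.mul_sum, ← Finset.sum_div]
          ring
  have hXX : ∑ p, X p ^ 2 ≤ N * (a + a ^ 2 + C * a) := by
    have h1 : ∑ p, X p ^ 2 = ∑ i, ∑ j, ∑ p, u i p * u j p := by
      simp only [X, sq, Finset.sum_mul_sum]
      rw [Finset.sum_comm]
      exact Finset.sum_congr rfl fun i _ => Finset.sum_comm
    have h2 : ∀ i, ∑ j, ∑ p, u i p * u j p ≤ N * (ε i + (ε i * a +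
        ∑ j with j ≠ i, (lam / d) ^ ((j : ℤ) - (i : ℤ)).natAbs * ((ε i + ε j) / 2))) := by
      intro i
      have hdiag : ∑ p, u i p * u i p = N * ε i := by
        rw [← G.sum_path_vertex_mem i (S i)]
        exact Finset.sum_congr rfl fun p _ => by simp only [u]; split_ifs <;> norm_num
      rw [← Finset.add_sum_erase _ _ (Finset.mem_univ i), hdiag, mul_add]
      refine add_le_add le_rfl ?_
      calc ∑ j ∈ Finset.univ.erase i, ∑ p, u i p * u j p
          ≤ ∑ j ∈ Finset.univ.erase i, N * (ε i * ε j +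
            (lam / d) ^ ((j : ℤ) - (i : ℤ)).natAbs * ((ε i + ε j) / 2)) :=
            Finset.sum_le_sum fun j _ =>
              G.sum_path_pair_mem_le_natAbs hlam0 hlam hG i j (S i) (S j)
        _ = N * (∑ j ∈ Finset.univ.erase i, ε i * ε j + ∑ j ∈ Finset.univ.erase i,
            (lam / d) ^ ((j : ℤ) - (i : ℤ)).natAbs * ((ε i + ε j) / 2)) := by
            rw [← Finset.mul_sum, Finset.sum_add_distrib]
        _ ≤ _ := by
            have he : Finset.univ.erase i = Finset.univ.filter (fun j => j ≠ i) := by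
              ext j; simp
            rw [← he]
            refine mul_le_mul_of_nonneg_left (add_le_add ?_ le_rfl) hN.le
            rw [Finset.mul_sum]
            exact Finset.sum_le_univ_sum_of_nonneg fun j => mul_nonneg (hε i) (hε j)
    rw [h1]
    refine (Finset.sum_le_sum fun i _ => h2 i).trans ?_
    rw [← Finset.mul_sum, Finset.sum_add_distrib, Finset.sum_add_distrib, ← Finset.sum_mul]
    refine mul_le_mul_of_nonneg_left ?_ hN.le
    change a + (a * a + _) ≤ _
    linarith
  -- The indicator `I` of a hit satisfies `I X = X` and `I² = I`, so Cauchy–Schwarz bounds the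
  -- hitting probability below by `(E X)² / E X²`.
  have hCS := Finset.sum_mul_sq_le_sq_mul_sq Finset.univ I X
  rw [hIX, hII] at hCS
  have hp := G.hitProb_nonneg S
  have h3 : (N * a) ^ 2 ≤ N * G.hitProb S * (N * (a + a ^ 2 + C * a)) :=
    hCS.trans (mul_le_mul_of_nonneg_left hXX (by positivity))
  have hC0 : 0 ≤ C := walkConst_nonneg _ hμ0
  exact le_mul_of_sq_le hN ha0 hC0 hp h3

end RegularGraph

/-- If `a ≤ ω`, the left side is at most `w a ≤ w p (K + a)`. If `a ≥ ω`, it is at most `1 ≤ ω w`,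
and monotonicity of `a / (K + a)` gives `ω ≤ p (K + ω)`. -/
theorem one_sub_prod_le_of_le_mul {ι : Type*} [Fintype ι] {K ω w a p : ℝ} (ε : ι → ℝ)
    (hε0 : ∀ j, 0 ≤ ε j) (hε1 : ∀ j, ε j ≤ 1) (ha : ∑ j, ε j = a) (hK : 0 ≤ K) (hw0 : 0 < w)
    (hw1 : w ≤ 1) (hω : 1 ≤ ω * w) (hp : 0 ≤ p) (h : a ≤ p * (K + a)) :
    1 - ∏ j, (1 - w * ε j) ≤ (K + ω) * w * p := by
  have ha0 : 0 ≤ a := ha ▸ Finset.sum_nonneg fun j _ => hε0 j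
  have hω0 : 0 < ω := by
    by_contra h'
    nlinarith
  rcases le_total a ω with hle | hle
  · have h1 := one_sub_le_prod_one_sub Finset.univ (fun j => w * ε j)
      (fun j _ => mul_nonneg hw0.le (hε0 j)) (fun j _ => mul_le_one₀ hw1 (hε0 j) (hε1 j))
    rw [← Finset.mul_sum, ha] at h1
    calc 1 - ∏ j, (1 - w * ε j) ≤ w * a := by linarith
      _ ≤ w * (p * (K + ω)) := by gcongr; exact h.trans (by gcongr)
      _ = (K + ω) * w * p := by ring
  · have h1 : 0 ≤ ∏ j, (1 - w * ε j) :=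
      Finset.prod_nonneg fun j _ => sub_nonneg.mpr (mul_le_one₀ hw1 (hε0 j) (hε1 j))
    have h2 : ω ≤ p * (K + ω) := by
      have h3 : ω * (K + a) ≤ p * (K + ω) * (K + a) := by
        have h4 : ω * (K + a) ≤ a * (K + ω) := by nlinarith
        nlinarith [mul_le_mul_of_nonneg_right h (by positivity : 0 ≤ K + ω)]
      exact le_of_mul_le_mul_right h3 (by linarith)
    nlinarith [mul_le_mul_of_nonneg_right h2 hw0.le]

/-! ### Operators that are functions of the joint outcome. -/

section Resolution

open scoped ComplexOrder MatrixOrder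

theorem real_smul_le_smul {n : Type*} {a b : ℝ} (h : a ≤ b)
    {A : Matrix n n ℂ} (hA : 0 ≤ A) : (a : ℂ) • A ≤ (b : ℂ) • A := by
  rw [Matrix.le_iff, ← sub_smul, ← Complex.ofReal_sub]
  exact (Matrix.nonneg_iff_posSemidef.mp hA).smul
    (by exact_mod_cast sub_nonneg.mpr h)

theorem real_smul_mono {n : Type*} {a : ℝ} (ha : 0 ≤ a)
    {A B : Matrix n n ℂ} (h : A ≤ B) : (a : ℂ) • A ≤ (a : ℂ) • B := by
  rw [Matrix.le_iff, ← smul_sub]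
  exact (Matrix.le_iff.mp h).smul (by exact_mod_cast ha)

theorem IsStarProjection.matrix_nonneg {n : Type*} [Fintype n] {A : Matrix n n ℂ}
    (h : IsStarProjection A) : 0 ≤ A := by
  rw [Matrix.nonneg_iff_posSemidef]
  have := Matrix.posSemidef_conjTranspose_mul_self A
  rwa [← Matrix.star_eq_conjTranspose, h.isSelfAdjoint.star_eq, h.isIdempotentElem.eq] at this

theorem one_nonneg_matrix {n : Type*} [DecidableEq n] [Finite n] : (0 : Matrix n n ℂ) ≤ 1 :=
  Matrix.nonneg_iff_posSemidef.mpr Matrix.PosSemidef.one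

variable {Q V : Type} [Fintype V] {T : ℕ}

/-- The function `c` of the joint outcome of measuring the resolution `P` on every register. -/
def outcomeOp (P : Finset V → QubitOp Q) (c : (Fin T → Finset V) → ℝ) : QubitOp (Fin T × Q) :=
  ∑ S, (c S : ℂ) • tensorOp (fun j => P (S j))

theorem outcomeOp_sub (P : Finset V → QubitOp Q) (c c' : (Fin T → Finset V) → ℝ) :
    outcomeOp P c - outcomeOp P c' = outcomeOp P (fun S => c S - c' S) := by
  simp only [outcomeOp, ← Finset.sum_sub_distrib, ← sub_smul, Complex.ofReal_sub]

theorem outcomeOp_smul (P : Finset V → QubitOp Q) (r : ℝ) (c : (Fin T → Finset V) → ℝ) :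
    (r : ℂ) • outcomeOp P c = outcomeOp P (fun S => r * c S) := by
  simp only [outcomeOp, Finset.smul_sum, smul_smul, Complex.ofReal_mul]

theorem outcomeOp_sum {ι : Type*} [Fintype ι] (P : Finset V → QubitOp Q)
    (c : ι → (Fin T → Finset V) → ℝ) :
    ∑ i, outcomeOp P (c i) = outcomeOp P (fun S => ∑ i, c i S) := by
  simp only [outcomeOp, Complex.ofReal_sum, Finset.sum_smul]
  exact Finset.sum_comm

theorem tensorOp_sum_smul (P : Finset V → QubitOp Q) (c : Fin T → Finset V → ℝ) :
    tensorOp (fun j => ∑ S, (c j S : ℂ) • P S) = outcomeOp P (fun S => ∏ j, c j (S j)) := by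
  have h := (tensorMultilinear Q T).map_sum (fun j (S : Finset V) => (c j S : ℂ) • P S)
  simp only [tensorMultilinear_apply] at h
  rw [h, outcomeOp]
  refine Finset.sum_congr rfl fun S _ => ?_
  have := (tensorMultilinear Q T).map_smul_univ (fun j => (c j (S j) : ℂ)) (fun j => P (S j))
  simp only [tensorMultilinear_apply] at this
  rw [this, Complex.ofReal_prod]

variable {P : Finset V → QubitOp Q} {p : V → QubitOp Q}

section

variable [DecidableEq V]

theorem average_eq (hp : ∀ i, ∑ S with i ∈ S, P S = p i) :
    ((Fintype.card V : ℂ)⁻¹) • ∑ i, p i =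
      ∑ S, (((S.card : ℝ) / Fintype.card V : ℝ) : ℂ) • P S := by
  simp only [← hp, Finset.sum_filter]
  rw [Finset.sum_comm, Finset.smul_sum]
  refine Finset.sum_congr rfl fun S _ => ?_
  rw [Finset.sum_ite_mem, Finset.univ_inter, Finset.sum_const, ← Nat.cast_smul_eq_nsmul ℂ, smul_smul]
  push_cast
  rw [div_eq_inv_mul]

end

variable [Fintype Q]

/-- The operator that acts as `A` on the register `k` and trivially on the others. -/
def onRegister (k : Fin T) (A : QubitOp Q) : QubitOp (Fin T × Q) :=
  tensorOp (Function.update (fun _ => 1) k A)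

theorem onRegister_sum_smul {ι : Type*} [Fintype ι] (k : Fin T) (c : ι → ℂ) (A : ι → QubitOp Q) :
    onRegister k (∑ i, c i • A i) = ∑ i, c i • onRegister k (A i) := by
  simp only [onRegister, ← tensorMultilinear_apply, MultilinearMap.map_update_sum,
    MultilinearMap.map_update_smul]

theorem outcomeOp_one (h1 : ∑ S, P S = 1) :
    outcomeOp P (fun _ : Fin T → Finset V => 1) = 1 := by
  have := tensorOp_sum_smul P (fun (_ : Fin T) _ => 1)
  simp only [Complex.ofReal_one, one_smul, h1, Finset.prod_const_one, tensorOp_one] at this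
  exact this.symm

/-- This is the reduction of operator inequalities within a layer to inequalities between real
functions of the outcome. -/
theorem outcomeOp_mono [DecidableEq Q] {P : Finset V → QubitOp Q} (hP : ∀ S, 0 ≤ P S)
    {c c' : (Fin T → Finset V) → ℝ} (h : ∀ S, c S ≤ c' S) : outcomeOp P c ≤ outcomeOp P c' :=
  Finset.sum_le_sum fun S _ => real_smul_le_smul (h S) (tensorOp_nonneg fun _ => hP _)

variable [DecidableEq V]

theorem one_sub_proj_eq (h1 : ∑ S, P S = 1) (hp : ∀ i, ∑ S with i ∈ S, P S = p i) (i : V) :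
    1 - p i = ∑ S, ((if i ∈ S then 0 else 1 : ℝ) : ℂ) • P S := by
  rw [← h1, ← hp, Finset.sum_filter, ← Finset.sum_sub_distrib]
  refine Finset.sum_congr rfl fun S _ => ?_
  split_ifs <;> simp

/-- At the outcome `S`, the term of a path takes the value `1` exactly when some vertex `f j` lies
in `S j`. -/
theorem pathAverage_eq {d : ℕ} [NeZero d] [Nonempty V] (G : RegularGraph V d)
    (h1 : ∑ S, P S = 1) (hp : ∀ i, ∑ S with i ∈ S, P S = p i) :
    ((Fintype.card (G.Path T) : ℂ)⁻¹) •
      ∑ f : G.Path T, (1 - tensorOp (fun j => 1 - p (f.vertex j))) =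
      outcomeOp P (fun S => G.hitProb S) := by
  have hf : ∀ f : G.Path T, 1 - tensorOp (fun j => 1 - p (f.vertex j)) =
      outcomeOp P (fun S => if ∃ j, f.vertex j ∈ S j then 1 else 0) := by
    intro f
    simp only [one_sub_proj_eq h1 hp]
    rw [tensorOp_sum_smul P (fun j S => if f.vertex j ∈ S then 0 else 1), ← outcomeOp_one h1,
      outcomeOp_sub]
    refine congrArg (outcomeOp P) (funext fun S => ?_)
    split_ifs with h
    · obtain ⟨j, hj⟩ := h
      rw [Finset.prod_eq_zero (f := fun j => if f.vertex j ∈ S j then (0 : ℝ) else 1)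
        (Finset.mem_univ j) (if_pos hj), sub_zero]
    · rw [Finset.prod_eq_one fun j _ => if_neg fun hj => h ⟨j, hj⟩, sub_self]
  simp only [hf]
  rw [outcomeOp_sum, show ((Fintype.card (G.Path T) : ℂ)⁻¹) =
    (((Fintype.card (G.Path T) : ℝ)⁻¹ : ℝ) : ℂ) by push_cast; rfl, outcomeOp_smul]
  refine congrArg (outcomeOp P) (funext fun S => ?_)
  rw [RegularGraph.hitProb, div_eq_inv_mul]

theorem one_sub_tensorOp_average_eq (h1 : ∑ S, P S = 1) (hp : ∀ i, ∑ S with i ∈ S, P S = p i)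
    (w : ℝ) :
    1 - tensorOp (fun _ : Fin T => 1 - (w : ℂ) • (((Fintype.card V : ℂ)⁻¹) • ∑ i, p i)) =
      outcomeOp P (fun S => 1 - ∏ j, (1 - w * ((S j).card / Fintype.card V))) := by
  have h : 1 - (w : ℂ) • (((Fintype.card V : ℂ)⁻¹) • ∑ i, p i) =
      ∑ S, ((1 - w * (S.card / Fintype.card V) : ℝ) : ℂ) • P S := by
    rw [average_eq hp, ← h1, Finset.smul_sum, ← Finset.sum_sub_distrib]
    refine Finset.sum_congr rfl fun S _ => ?_
    rw [Complex.ofReal_sub, sub_smul, Complex.ofReal_one, one_smul, Complex.ofReal_mul, smul_smul]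
  rw [h, tensorOp_sum_smul P (fun _ S => 1 - w * (S.card / Fintype.card V)), ← outcomeOp_one h1,
    outcomeOp_sub]

theorem onRegister_average_eq (h1 : ∑ S, P S = 1) (hp : ∀ i, ∑ S with i ∈ S, P S = p i)
    (k : Fin T) :
    onRegister k (((Fintype.card V : ℂ)⁻¹) • ∑ i, p i) =
      outcomeOp P (fun S => (S k).card / Fintype.card V) := by
  have h : Function.update (fun _ => (1 : QubitOp Q)) k (((Fintype.card V : ℂ)⁻¹) • ∑ i, p i) =
      fun j => ∑ S, ((if j = k then S.card / Fintype.card V else 1 : ℝ) : ℂ) • P S := by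
    funext j
    rcases eq_or_ne j k with rfl | hj
    · simp only [Function.update_self, if_true]
      exact average_eq hp
    · simp [hj, h1]
  rw [onRegister, h,
    tensorOp_sum_smul P (fun j S => if j = k then (S.card : ℝ) / Fintype.card V else 1)]
  refine congrArg (outcomeOp P) (funext fun S => ?_)
  simp

end Resolution

/-! ### Operator bounds for the amplified Hamiltonian. -/

namespace LayeredHamiltonian

open scoped ComplexOrder MatrixOrder

variable {Q : Type} [Fintype Q] [DecidableEq Q] (H : LayeredHamiltonian Q)

theorem layer_nonneg (χ : Fin H.g) : 0 ≤ H.layer χ := by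
  have h := real_smul_mono (a := (Fintype.card (H.Term χ) : ℝ)⁻¹) (by positivity)
    (Finset.sum_nonneg fun i (_ : i ∈ Finset.univ) => (H.isProj χ i).matrix_nonneg)
  rw [smul_zero] at h
  simpa [layer] using h

theorem layer_le_one (χ : Fin H.g) : H.layer χ ≤ 1 := by
  have h0 : ∑ i, H.proj χ i ≤ ∑ _i : H.Term χ, (1 : QubitOp Q) :=
    Finset.sum_le_sum fun i _ => sub_nonneg.mp (H.isProj χ i).one_sub.matrix_nonneg
  have h := real_smul_mono (a := (Fintype.card (H.Term χ) : ℝ)⁻¹) (by positivity) h0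
  have hc : (Fintype.card (H.Term χ) : ℂ) ≠ 0 := by exact_mod_cast Fintype.card_ne_zero
  rw [Finset.sum_const, Finset.card_univ, ← Nat.cast_smul_eq_nsmul ℂ, smul_smul] at h
  push_cast at h
  rwa [inv_mul_cancel₀ hc, one_smul] at h

theorem weighted_layer_nonneg (χ : Fin H.g) : 0 ≤ (H.w χ : ℂ) • H.layer χ := by
  have := real_smul_mono (H.w_pos χ).le (H.layer_nonneg χ)
  rwa [smul_zero] at this

theorem op_nonneg : 0 ≤ H.op := Finset.sum_nonneg fun χ _ => H.weighted_layer_nonneg χ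

theorem op_isHermitian : H.op.IsHermitian := (Matrix.nonneg_iff_posSemidef.mp H.op_nonneg).1

theorem op_le_one : H.op ≤ 1 := by
  have h : H.op ≤ ∑ χ, (H.w χ : ℂ) • (1 : QubitOp Q) :=
    Finset.sum_le_sum fun χ _ => real_smul_mono (H.w_pos χ).le (H.layer_le_one χ)
  rwa [← Finset.sum_smul, ← Complex.ofReal_sum, H.w_sum, Complex.ofReal_one, one_smul] at h

theorem w_le_one (χ : Fin H.g) : H.w χ ≤ 1 := by
  rw [← H.w_sum]
  exact Finset.single_le_sum (fun i _ => (H.w_pos i).le) (Finset.mem_univ χ)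

theorem one_le_omegaMin_mul (χ : Fin H.g) : 1 ≤ H.omegaMin * H.w χ := by
  have : Nonempty (Fin H.g) := ⟨χ⟩
  obtain ⟨i, hi⟩ := exists_eq_ciInf_of_finite (f := H.w)
  have hle : H.w i ≤ H.w χ := hi ▸ ciInf_le (Set.finite_range H.w).bddBelow χ
  rw [omegaMin, ← hi, inv_mul_eq_div, le_div_iff₀ (H.w_pos i), one_mul]
  exact hle

theorem lambdaMin_op_nonneg : 0 ≤ lambdaMin H.op :=
  le_lambdaMin H.op_isHermitian (by simpa using H.op_nonneg)

theorem lambdaMin_op_le_one : lambdaMin H.op ≤ 1 := by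
  have h := (lambdaMin_smul_one_le H.op_isHermitian).trans H.op_le_one
  -- Any diagonal entry serves to compare the two scalars.
  have := (Matrix.le_iff.mp h).diag_nonneg (i := fun _ => 0)
  simp only [Matrix.sub_apply, Matrix.smul_apply, Matrix.one_apply_eq, smul_eq_mul, mul_one] at this
  have h2 : ((lambdaMin H.op : ℝ) : ℂ) ≤ ((1 : ℝ) : ℂ) := by
    simpa using sub_nonneg.mp this
  exact_mod_cast h2

variable {d : ℕ} [NeZero d] (G : ∀ χ, RegularGraph (H.Term χ) d) (T : ℕ)

-- With one resolution `P` for the layer, the three bounds become `ε k ≤ p`, the union bound `p ≤ ∑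
-- ε j`, and the second moment estimate.
open Classical in
theorem amplify_layer_bounds (χ : Fin H.g) :
    (∀ k, onRegister k (H.layer χ) ≤ (H.amplify G T).layer χ) ∧
    (H.amplify G T).layer χ ≤ ∑ k, onRegister k (H.layer χ) ∧
    ∀ lam : ℝ, 0 ≤ lam → lam < d → (G χ).IsSpectralExpander lam →
      1 - tensorOp (fun _ : Fin T => 1 - (H.w χ : ℂ) • H.layer χ) ≤
        ((1 + walkConst (lam / d) + H.omegaMin : ℝ) : ℂ) •
          (H.w χ : ℂ) • (H.amplify G T).layer χ := by
  obtain ⟨P, hP, h1, hp⟩ := exists_joint_resolution (H.proj χ) (H.isProj χ) (H.commute χ)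
  have hP0 : ∀ S, 0 ≤ P S := fun S => (hP S).matrix_nonneg
  have hlayer : (H.amplify G T).layer χ = outcomeOp P (fun S => (G χ).hitProb S) :=
    pathAverage_eq (G χ) h1 hp
  have hreg : ∀ k : Fin T, onRegister k (H.layer χ) =
      outcomeOp P (fun S => (S k).card / Fintype.card (H.Term χ)) :=
    onRegister_average_eq h1 hp
  refine ⟨fun k => ?_, ?_, fun lam hlam0 hlam hG => ?_⟩
  · rw [hreg, hlayer]
    exact outcomeOp_mono hP0 fun S => (G χ).le_hitProb S k
  · simp only [hreg, hlayer, outcomeOp_sum]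
    exact outcomeOp_mono hP0 fun S => (G χ).hitProb_le_sum S
  · rw [layer, one_sub_tensorOp_average_eq h1 hp, hlayer, outcomeOp_smul, outcomeOp_smul]
    refine outcomeOp_mono hP0 fun S => ?_
    rw [← mul_assoc]
    have hm : (0 : ℝ) < Fintype.card (H.Term χ) := by exact_mod_cast Fintype.card_pos
    refine one_sub_prod_le_of_le_mul (fun j => ((S j).card : ℝ) / Fintype.card (H.Term χ))
      (fun j => by positivity) (fun j => ?_) rfl ?_ (H.w_pos χ) (H.w_le_one χ)
      (H.one_le_omegaMin_mul χ) ((G χ).hitProb_nonneg S)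
      ((G χ).sum_le_hitProb_mul hlam0 hlam hG S)
    · rw [div_le_one hm]
      exact_mod_cast Finset.card_le_univ (S j)
    · have := walkConst_nonneg (lam / d) (by positivity)
      positivity

theorem onRegister_op_eq (k : Fin T) :
    onRegister k H.op = ∑ χ, (H.w χ : ℂ) • onRegister k (H.layer χ) :=
  onRegister_sum_smul k _ _

theorem onRegister_op_le_amplify_op (k : Fin T) : onRegister k H.op ≤ (H.amplify G T).op := by
  rw [onRegister_op_eq]
  exact Finset.sum_le_sum fun χ _ =>
    real_smul_mono (H.w_pos χ).le ((H.amplify_layer_bounds G T χ).1 k)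

theorem amplify_op_le_sum_onRegister : (H.amplify G T).op ≤ ∑ k : Fin T, onRegister k H.op := by
  simp only [onRegister_op_eq]
  rw [Finset.sum_comm]
  simp only [← Finset.smul_sum]
  exact Finset.sum_le_sum fun χ _ =>
    real_smul_mono (H.w_pos χ).le (H.amplify_layer_bounds G T χ).2.1

theorem one_sub_tensorOp_le_smul_amplify_op {lam : ℝ} (hlam0 : 0 ≤ lam) (hlam : lam < d)
    (hG : ∀ χ, (G χ).IsSpectralExpander lam) :
    1 - tensorOp (fun _ : Fin T => 1 - H.op) ≤
      ((1 + walkConst (lam / d) + H.omegaMin : ℝ) : ℂ) • (H.amplify G T).op := by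
  refine (one_sub_tensorOp_sum_le _ H.weighted_layer_nonneg H.op_le_one).trans ?_
  rw [op, Finset.smul_sum]
  exact Finset.sum_le_sum fun χ _ => (H.amplify_layer_bounds G T χ).2.2 lam hlam0 hlam (hG χ)

theorem lambdaMin_le_lambdaMin_amplify (hT : 1 ≤ T) :
    lambdaMin H.op ≤ lambdaMin (H.amplify G T).op := by
  refine le_lambdaMin (H.amplify G T).op_isHermitian
    (le_trans ?_ (H.onRegister_op_le_amplify_op G T ⟨0, hT⟩))
  have h : (lambdaMin H.op : ℂ) • (1 : QubitOp (Fin T × Q)) =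
      onRegister ⟨0, hT⟩ ((lambdaMin H.op : ℂ) • 1) := by
    rw [onRegister, ← tensorMultilinear_apply, MultilinearMap.map_update_smul]
    congr 1
    rw [tensorMultilinear_apply, Function.update_eq_self, tensorOp_one]
  rw [h]
  have h0 : (0 : QubitOp Q) ≤ (lambdaMin H.op : ℂ) • 1 := by
    have := real_smul_mono H.lambdaMin_op_nonneg (one_nonneg_matrix (n := Q → Fin 2))
    rwa [smul_zero] at this
  refine tensorOp_mono (fun j => ?_) (fun j => ?_)
  · rcases eq_or_ne j ⟨0, hT⟩ with rfl | hj
    · simpa using h0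
    · simp [hj]
  · rcases eq_or_ne j ⟨0, hT⟩ with rfl | hj
    · simpa using lambdaMin_smul_one_le H.op_isHermitian
    · simp [hj]

/-- The trial state is `φ ⊗ ⋯ ⊗ φ` for a ground state `φ` of `H`; each register contributes
`lambdaMin H.op`. -/
theorem lambdaMin_amplify_le : lambdaMin (H.amplify G T).op ≤ T * lambdaMin H.op := by
  obtain ⟨φ, hφ1, hφ⟩ := exists_lambdaMin_eigenvector H.op_isHermitian
  have h := (lambdaMin_smul_one_le (H.amplify G T).op_isHermitian).trans
    (H.amplify_op_le_sum_onRegister G T)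
  have h2 := (Matrix.le_iff.mp h).dotProduct_mulVec_nonneg (tensorVec T φ)
  have hone : star (tensorVec T φ) ⬝ᵥ tensorVec T φ = 1 := by
    have := dotProduct_tensorOp_mulVec (fun _ : Fin T => (1 : QubitOp Q)) φ
    simpa [tensorOp_one, hφ1] using this
  have hreg : ∀ k : Fin T,
      star (tensorVec T φ) ⬝ᵥ (onRegister k H.op).mulVec (tensorVec T φ) = lambdaMin H.op := by
    intro k
    rw [onRegister, dotProduct_tensorOp_mulVec, Finset.prod_eq_single k]
    · simpa using hφ
    · intro j _ hj
      simp [hj, hφ1]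
    · simp
  rw [Matrix.sub_mulVec, dotProduct_sub, Matrix.sum_mulVec, dotProduct_sum, Matrix.smul_mulVec,
    Matrix.one_mulVec, dotProduct_smul, hone] at h2
  simp only [hreg, Finset.sum_const, Finset.card_univ, Fintype.card_fin, nsmul_eq_mul,
    smul_eq_mul, mul_one, sub_nonneg] at h2
  exact_mod_cast h2

theorem one_sub_pow_le_mul_lambdaMin_amplify {lam : ℝ} (hlam0 : 0 ≤ lam) (hlam : lam < d)
    (hG : ∀ χ, (G χ).IsSpectralExpander lam) :
    1 - (1 - lambdaMin H.op) ^ T ≤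
      (1 + walkConst (lam / d) + H.omegaMin) * lambdaMin (H.amplify G T).op := by
  have hC := walkConst_nonneg (lam / d) (by positivity)
  have hω : 0 ≤ H.omegaMin := inv_nonneg.mpr (Real.iInf_nonneg fun χ => (H.w_pos χ).le)
  set M : ℝ := 1 + walkConst (lam / d) + H.omegaMin with hM
  have hM0 : 0 < M := by positivity
  have h1 : tensorOp (fun _ : Fin T => 1 - H.op) ≤
      (((1 - lambdaMin H.op) ^ T : ℝ) : ℂ) • (1 : QubitOp (Fin T × Q)) := by
    have h2 := tensorOp_mono (T := T) (fun _ => sub_nonneg.mpr H.op_le_one)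
      (fun _ => sub_le_sub_left (lambdaMin_smul_one_le H.op_isHermitian) 1)
    refine h2.trans (le_of_eq ?_)
    have h3 := (tensorMultilinear Q T).map_smul_univ
      (fun _ => ((1 - lambdaMin H.op : ℝ) : ℂ)) (fun _ => 1)
    simp only [tensorMultilinear_apply, tensorOp_one, Finset.prod_const, Finset.card_univ,
      Fintype.card_fin] at h3
    rw [Complex.ofReal_pow, ← h3]
    congr 1
    funext j
    rw [Complex.ofReal_sub, sub_smul, Complex.ofReal_one, one_smul]
  have h4 := (sub_le_sub_left h1 1).trans
    (H.one_sub_tensorOp_le_smul_amplify_op G T hlam0 hlam hG)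
  have h5 := real_smul_mono (inv_nonneg.mpr hM0.le) h4
  rw [smul_smul, ← Complex.ofReal_mul, inv_mul_cancel₀ hM0.ne', Complex.ofReal_one, one_smul] at h5
  have h6 : M⁻¹ * (1 - (1 - lambdaMin H.op) ^ T) ≤ lambdaMin (H.amplify G T).op := by
    refine le_lambdaMin (H.amplify G T).op_isHermitian (le_trans (le_of_eq ?_) h5)
    rw [Complex.ofReal_mul, mul_smul, Complex.ofReal_sub, sub_smul, Complex.ofReal_one, one_smul]
  rwa [inv_mul_le_iff₀ hM0] at h6

theorem numTerms_amplify (hT : 1 ≤ T) :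
    (H.amplify G T).numTerms = d ^ (T - 1) * H.numTerms := by
  rw [numTerms, numTerms, Finset.mul_sum]
  exact Finset.sum_congr rfl fun (χ : Fin H.g) _ => (G χ).card_path T hT

end LayeredHamiltonian

/-! ### Locality of the amplified terms. -/

section Locality

variable {Q : Type} {T : ℕ}

theorem QubitOp.ActsOn.one_sub [Fintype Q] {A : QubitOp Q} {S : Finset Q} (h : A.ActsOn S) :
    (1 - A).ActsOn S := by
  classical
  obtain ⟨B, hB⟩ := h
  refine ⟨1 - B, fun x y => ⟨fun hxy => ?_, fun hxy => ?_⟩⟩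
  · rw [Matrix.sub_apply, Matrix.sub_apply, (hB x y).1 hxy]
    congr 1
    rw [Matrix.one_apply, Matrix.one_apply]
    refine if_congr ⟨fun h => by rw [h], fun h => ?_⟩ rfl rfl
    funext q
    by_cases hq : q ∈ S
    · exact congrFun h ⟨q, hq⟩
    · exact hxy q hq
  · rw [Matrix.sub_apply, (hB x y).2 hxy, sub_zero, Matrix.one_apply_ne]
    rintro rfl
    exact hxy fun _ _ => rfl

theorem tensorOp_actsOn {A : Fin T → QubitOp Q} {S : Fin T → Finset Q}
    (h : ∀ j, (A j).ActsOn (S j)) :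
    (tensorOp A).ActsOn ((Finset.univ.sigma S).map (Equiv.sigmaEquivProd (Fin T) Q).toEmbedding) := by
  choose B hB using h
  have hmem : ∀ j q, (j, q) ∈ (Finset.univ.sigma S).map
      (Equiv.sigmaEquivProd (Fin T) Q).toEmbedding ↔ q ∈ S j := by
    intro j q
    simp [Finset.mem_map_equiv]
  refine ⟨Matrix.of fun x y => ∏ j, B j (fun q => x ⟨(j, q), (hmem j q).mpr q.2⟩)
    (fun q => y ⟨(j, q), (hmem j q).mpr q.2⟩), fun x y => ⟨fun hxy => ?_, fun hxy => ?_⟩⟩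
  · simp only [tensorOp, Matrix.of_apply]
    exact Finset.prod_congr rfl fun j _ => (hB j _ _).1 fun q hq =>
      hxy (j, q) fun h => hq ((hmem j q).mp h)
  · push Not at hxy
    obtain ⟨⟨j, q⟩, hq, hne⟩ := hxy
    simp only [tensorOp, Matrix.of_apply]
    refine Finset.prod_eq_zero (Finset.mem_univ j) ((hB j _ _).2 fun h => hne (h q fun hqS => ?_))
    exact hq ((hmem j q).mpr hqS)

theorem QubitOp.IsLocal.one_sub_tensorOp [Fintype Q] {k : ℕ} {A : Fin T → QubitOp Q}
    (h : ∀ j, (A j).IsLocal k) : (1 - tensorOp fun j => 1 - A j).IsLocal (T * k) := by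
  choose S hS hA using h
  refine ⟨_, ?_, (tensorOp_actsOn fun j => (hA j).one_sub).one_sub⟩
  rw [Finset.card_map, Finset.card_sigma]
  calc ∑ j, (S j).card ≤ ∑ _j : Fin T, k := Finset.sum_le_sum fun j _ => hS j
    _ = T * k := by simp

end Locality

/-! ### Numerical estimates and conclusion. -/

/-- If `l` is at least `log t / (3 t)`, then `l ≤ e` suffices. Otherwise `2 t l ≤ log t`, so the
saturating fraction in `h` is at least `l t / log t`, which dominates the square root version. The
size of `t` is needed only for `t > 0` and `log t ≥ 1`. -/
theorem min_le_of_soundness_bounds {t l C ω e : ℝ} (ht : 10 ^ 5 ≤ t) (hl0 : 0 ≤ l)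
    (hC : 0 ≤ C) (hle : l ≤ e) (h : 2 * t * l / (1 + 2 * t * l) ≤ (1 + C + ω) * e) :
    min (1 / 3 * (Real.log t / t))
      (l * Real.sqrt (t / Real.log t) * (1 / 20 * (max (1 + C) ω)⁻¹)) ≤ e := by
  have ht0 : 0 < t := by linarith
  have hlog1 : 1 ≤ Real.log t := by
    rw [Real.le_log_iff_exp_le ht0]
    have := Real.exp_one_lt_d9
    linarith
  have hlogt : Real.log t ≤ t := (Real.log_le_sub_one_of_pos ht0).trans (by linarith)
  rcases le_total (1 / 3 * (Real.log t / t)) l with h1 | h1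
  · exact (min_le_left _ _).trans (h1.trans hle)
  refine (min_le_right _ _).trans ?_
  set L := Real.log t
  have hL0 : 0 < L := by linarith
  set M := max (1 + C) ω
  have hM1 : 1 + C ≤ M := le_max_left _ _
  have hM2 : ω ≤ M := le_max_right _ _
  have hM0 : 0 < M := by linarith
  have he0 : 0 ≤ e := hl0.trans hle
  have htl : 2 * t * l ≤ L := by
    have h2 : t * l ≤ t * (1 / 3 * (L / t)) := mul_le_mul_of_nonneg_left h1 ht0.le
    have h3 : t * (1 / 3 * (L / t)) = L / 3 := by field_simp
    linarith
  have hsqrt : Real.sqrt (t / L) ≤ t / L := by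
    have h2 : 1 ≤ t / L := (one_le_div hL0).mpr hlogt
    exact Real.sqrt_le_iff.mpr ⟨by positivity, by nlinarith⟩
  have h2 : l * (t / L) ≤ 2 * t * l / (1 + 2 * t * l) := by
    have h3 : 0 ≤ t * l := by positivity
    rw [mul_div_assoc', div_le_div_iff₀ hL0 (by linarith)]
    nlinarith [mul_le_mul_of_nonneg_left (show 1 + 2 * t * l ≤ 2 * L by linarith) h3]
  -- The sum `1 + C + ω` is at most twice the maximum `M`; against the constant `1 / 20` this leaves
  -- a factor `10` to spare.
  have h3 : l * (t / L) ≤ 2 * M * e :=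
    h2.trans (h.trans (mul_le_mul_of_nonneg_right (by linarith) he0))
  have h4 : l * Real.sqrt (t / L) ≤ 2 * M * e := (mul_le_mul_of_nonneg_left hsqrt hl0).trans h3
  calc l * Real.sqrt (t / L) * (1 / 20 * M⁻¹) ≤ 2 * M * e * (1 / 20 * M⁻¹) :=
        mul_le_mul_of_nonneg_right h4 (by positivity)
    _ = e / 10 := by field_simp; ring
    _ ≤ e := by linarith

/-- Bernoulli's inequality gives `(1 - l)^n (1 + n l) ≤ (1 - l²)^n ≤ 1`. -/
theorem div_one_add_le_one_sub_pow {l : ℝ} (h0 : 0 ≤ l) (h1 : l ≤ 1) (n : ℕ) :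
    n * l / (1 + n * l) ≤ 1 - (1 - l) ^ n := by
  have hn : 0 ≤ n * l := by positivity
  have h2 : (1 - l) ^ n * (1 + n * l) ≤ 1 := by
    calc (1 - l) ^ n * (1 + n * l) ≤ (1 - l) ^ n * (1 + l) ^ n :=
          mul_le_mul_of_nonneg_left (one_add_mul_le_pow (by linarith) n)
            (pow_nonneg (by linarith) n)
      _ = (1 - l ^ 2) ^ n := by rw [← mul_pow]; ring
      _ ≤ 1 := pow_le_one₀ (by nlinarith) (by nlinarith)
  rw [div_le_iff₀ (by linarith)]
  nlinarith

theorem theorem1p1 {Q : Type} [Fintype Q] [DecidableEq Q] (H : LayeredHamiltonian Q)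
    (d : ℕ) [NeZero d] (lam : ℝ) (hlam0 : 0 ≤ lam) (hlam : lam < d)
    (G : ∀ χ, RegularGraph (H.Term χ) d) (hG : ∀ χ, (G χ).IsSpectralExpander lam)
    (t : ℕ) (ht : 1 ≤ t) :
    -- locality and number of terms
    (∀ k : ℕ, H.IsLocal k → (H.amplify G (2 * t)).IsLocal (2 * t * k)) ∧
    (H.amplify G (2 * t)).numTerms = d ^ (2 * t - 1) * H.numTerms ∧
    (H.amplify G (2 * t)).numTerms ≤ d ^ (2 * t) * H.numTerms ∧
    -- completeness
    lambdaMin (H.amplify G (2 * t)).op ≤ 2 * (t : ℝ) * lambdaMin H.op ∧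
    -- soundness
    walkConst (lam / d) ≤ 2 / (1 - lam / d) ∧
    (10 ^ 5 ≤ t →
      min (1 / 3 * (Real.log t / t))
        (lambdaMin H.op * Real.sqrt (t / Real.log t) *
          (1 / 20 * (max (1 + walkConst (lam / d)) H.omegaMin)⁻¹))
      ≤ lambdaMin (H.amplify G (2 * t)).op) := by
  have hd : (0 : ℝ) < d := by exact_mod_cast Nat.pos_of_ne_zero (NeZero.ne d)
  have hμ0 : 0 ≤ lam / d := by positivity
  have hμ1 : lam / d < 1 := (div_lt_one hd).mpr hlam
  have hnum := H.numTerms_amplify G (2 * t) (by omega)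
  refine ⟨fun k hk χ f => QubitOp.IsLocal.one_sub_tensorOp fun j => hk χ _, hnum, ?_, ?_,
    walkConst_le hμ0 hμ1, fun ht5 => ?_⟩
  · rw [hnum]
    exact Nat.mul_le_mul_right _
      (Nat.pow_le_pow_right (Nat.pos_of_ne_zero (NeZero.ne d)) (Nat.sub_le _ _))
  · have := H.lambdaMin_amplify_le G (2 * t)
    push_cast at this
    exact this
  · refine min_le_of_soundness_bounds (by exact_mod_cast ht5) H.lambdaMin_op_nonneg
      (walkConst_nonneg _ hμ0) (H.lambdaMin_le_lambdaMin_amplify G (2 * t) (by omega)) ?_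
    refine le_trans ?_ (H.one_sub_pow_le_mul_lambdaMin_amplify G (2 * t) hlam0 hlam hG)
    have := div_one_add_le_one_sub_pow H.lambdaMin_op_nonneg H.lambdaMin_op_le_one (2 * t)
    push_cast at this
    exact this
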